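/- Let $k$ be a field of characteristic zero. A $k$-variety is a reduced separated $k$-scheme of finite type, and an algebraic group over $k$ is a group object in $k$-varieties (in characteristic zero these are exactly the $k$-group schemes of finite type). An action of an algebraic group $G$ on a variety is good if every $G$-orbit is contained in an affine open subset. Let $G$ be an algebraic group over $k$, let $X, Y, F$ be $k$-varieties with good $G$-actions, and let $f\colon X\to Y$ be a $G$-equivariant morphism. Assume that the categorical quotient $Y\to Y/\!/G$ (in $k$-schemes) exists and is quasi-finite, or that $G$ is finite. Then the following are equivalent. (1) $f$ is a $G$-equivariant piecewise trivial fibration with fiber $F$: there is a finite partition of $Y$ into $G$-invariant locally closed subsets $B_i$ (with their reduced structure and induced action) such that for each $i$ there is a $G$-equivariant isomorphism $X\times_Y B_i\cong B_i\times_k F$ (diagonal action on the right) under which the projection to $B_i$ corresponds to the first projection. (2) For every point $y\in Y$ with residue field $k(y)$, there is a $G_y$-equivariant isomorphism of $k(y)$-schemes $\Phi\colon X_y=X\times_Y\operatorname{Spec}k(y)\to F\times_k k(y)$. Here $G_y$ is the stabilizer of the point $y$ of the scheme $Y$: for a $k$-scheme $T$, its $T$-points are the pairs $(g,t)$ with $g\in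 G(T)$ and $t\in Y(T)$ factoring through $\operatorname{Spec}k(y)\to Y$ such that $gt$ also factors through $\operatorname{Spec}k(y)\to Y$. Equivariance of $\Phi$ means that, for all such $T$ and $(g,t)$ and every $x\in X_y(T)$ lying over $t$, one has $\Phi(gx)=g\,\Phi(x)$, where $g(t,a)=(gt,ga)$ on $\operatorname{Spec}k(y)\times_k F$. (If $y$ is $k$-rational, $G_y$ is the usual stabilizer subgroup scheme; if $G$ is a constant finite group, it is given by the subgroup of all $g\in G$ with $gy=y$, which may act nontrivially on $k(y)$.) -/

import Mathlib

open CategoryTheory Limits MonoidalCategory CartesianMonoidalCategory AlgebraicGeometry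
open scoped MonObj

universe u

noncomputable section

namespace EquivariantFibration

/-- `k`-schemes. Products over `k` are written `⊗`; for `g : T ⟶ G` and `x : T ⟶ X` (two
`T`-valued points), with `G` acting on `X`, Mathlib writes `g • x : T ⟶ X` for the translate. -/
abbrev Sch (k : Type u) [Field k] : Type (u + 1) := Over (Spec (CommRingCat.of k))

variable {k : Type u} [Field k]

/-- An algebraic `k`-variety: a reduced separated `k`-scheme of finite type
(not necessarily irreducible). -/
structure IsVariety (X : Sch k) : Prop where
  isReduced : IsReduced X.left
  isSeparated : IsSeparated X.hom
  locallyOfFiniteType : LocallyOfFiniteType X.hom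
  quasiCompact : QuasiCompact X.hom

/-- The action morphism `G ×_k X ⟶ X`. -/
abbrev act (G X : Sch k) [GrpObj G] [ModObj G X] : G ⊗ X ⟶ X := γ[G, X]

/-- The `G`-orbit of a point `x` of the underlying space of `X`: the image of `G × {x}` under the
action morphism. -/
def orbit (G : Sch k) [GrpObj G] {X : Sch k} [ModObj G X] (x : X.left) : Set X.left :=
  {x' | ∃ z : (G ⊗ X : Sch k).left,
    (snd G X).left z = x ∧ (act G X).left z = x'}

/-- A good action: every orbit is contained in an affine open subset. -/
def IsGoodAction (G X : Sch k) [GrpObj G] [ModObj G X] : Prop :=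
  ∀ x : X.left, ∃ U : X.left.Opens, IsAffineOpen U ∧ orbit G x ⊆ (U : Set X.left)

/-- `q : Y ⟶ Q` is a categorical quotient of `Y` by `G`: it is `G`-invariant, and every
`G`-invariant morphism of `k`-schemes `Y ⟶ Z` factors uniquely through it. -/
structure IsCategoricalQuotient (G : Sch k) [GrpObj G] {Y Q : Sch k} [ModObj G Y]
    (q : Y ⟶ Q) : Prop where
  invariant : act G Y ≫ q = snd G Y ≫ q
  existsUnique_factor : ∀ (Z : Sch k) (h : Y ⟶ Z),
    act G Y ≫ h = snd G Y ≫ h → ∃! h' : Q ⟶ Z, q ≫ h' = h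

/-- Quasi-finite morphisms: of finite type, with finite fibres. -/
structure IsQuasiFinite {X Y : Scheme.{u}} (f : X ⟶ Y) : Prop where
  locallyOfFiniteType : LocallyOfFiniteType f
  quasiCompact : QuasiCompact f
  locallyQuasiFinite : LocallyQuasiFinite f

/-! ### Equivariant piecewise trivial fibrations -/

section Strata

variable (G : Sch k) [GrpObj G] {X Y : Sch k} [ModObj G X] [ModObj G Y]
  (f : X ⟶ Y) [IsModHom G f] {S : Sch k} [ModObj G S] (j : S ⟶ Y) [IsModHom G j]

variable {G} in
/-- The induced action of `G` on `X_S = X ×_Y S`, on `T`-valued points: `g (x, s) = (g x, g s)`. -/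
def smulPullback {T : Sch k} (g : T ⟶ G) (x : T ⟶ pullback f j) : T ⟶ pullback f j :=
  pullback.lift (g • (x ≫ pullback.fst f j)) (g • (x ≫ pullback.snd f j)) (by
    rw [IsModHom.map_smul, IsModHom.map_smul, Category.assoc, Category.assoc, pullback.condition])

variable {G} in
/-- The diagonal action of `G` on `S ×_k F`, on `T`-valued points: `g (s, a) = (g s, g a)`. -/
def smulProd {S F : Sch k} [ModObj G S] [ModObj G F] {T : Sch k}
    (g : T ⟶ G) (p : T ⟶ S ⊗ F) : T ⟶ S ⊗ F :=
  lift (g • (p ≫ fst S F)) (g • (p ≫ snd S F))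

/-- There is a `G`-equivariant isomorphism `X_S ≅ S ×_k F`, for the diagonal action on the right,
under which the projection `X_S ⟶ S` corresponds to the first projection. -/
def IsTrivialOverStratum (F : Sch k) [ModObj G F] : Prop :=
  ∃ Φ : pullback f j ≅ S ⊗ F,
    Φ.hom ≫ fst S F = pullback.snd f j ∧
    ∀ (T : Sch k) (g : T ⟶ G) (x : T ⟶ pullback f j),
      smulPullback f j g x ≫ Φ.hom = smulProd g (x ≫ Φ.hom)

end Strata

/-- `f` is a `G`-equivariant piecewise trivial fibration with fibre `F`. The `G`-invariant locally
closed subsets forming the finite partition of `Y`, with their reduced structure and the induced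
action, are presented as reduced `G`-schemes with a `G`-equivariant immersion into `Y`. -/
def IsPiecewiseTrivialFibration (G : Sch k) [GrpObj G] {X Y : Sch k} [ModObj G X] [ModObj G Y]
    (f : X ⟶ Y) [IsModHom G f] (F : Sch k) [ModObj G F] : Prop :=
  ∃ (n : ℕ) (S : Fin n → Sch k) (_ : ∀ i, ModObj G (S i)) (j : ∀ i, S i ⟶ Y)
    (_ : ∀ i, IsModHom G (j i)),
    (∀ i, IsReduced (S i).left ∧ IsImmersion (j i).left) ∧
    (Pairwise fun a b => Disjoint (Set.range (j a).left) (Set.range (j b).left)) ∧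
    (⋃ i, Set.range (j i).left) = Set.univ ∧
    ∀ i, IsTrivialOverStratum G f (j i) F

/-! ### Fibres and stabilizers -/

/-- `Spec k(y)` as a `k`-scheme. -/
def pt {Y : Sch k} (y : Y.left) : Sch k :=
  Over.mk (Y.left.fromSpecResidueField y ≫ Y.hom)

/-- The canonical monomorphism `Spec k(y) ⟶ Y`. -/
def ptι {Y : Sch k} (y : Y.left) : pt y ⟶ Y :=
  Over.homMk (Y.left.fromSpecResidueField y) rfl

section Fibres

variable (G : Sch k) [GrpObj G] {X Y : Sch k} [ModObj G X] [ModObj G Y]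

/-- The stabilizer `G_y` of the point `y`. Its `T`-valued points are the pairs `(g, t)` with
`g ∈ G(T)` and `t ∈ Y(T)` lying at `y` (i.e. factoring through `Spec k(y)`) such that `g t` again
lies at `y`. If `y` is `k`-rational this is the usual stabilizer subgroup scheme of `G`; if `G` is
a constant group it is the disjoint union of copies of `Spec k(y)` indexed by the subgroup of those
`g` with `g y = y`. -/
abbrev stabilizer (y : Y.left) : Sch k :=
  pullback (G ◁ ptι y ≫ act G Y) (ptι y)

/-- `(g, t) ↦ g`. -/
def stabilizerElt (y : Y.left) : stabilizer G y ⟶ G :=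
  pullback.fst _ _ ≫ fst G (pt y)

/-- `(g, t) ↦ t`. -/
def stabilizerSrc (y : Y.left) : stabilizer G y ⟶ pt y :=
  pullback.fst _ _ ≫ snd G (pt y)

/-- `(g, t) ↦ g t`. -/
def stabilizerTgt (y : Y.left) : stabilizer G y ⟶ pt y :=
  pullback.snd _ _

variable {G} in
theorem stabilizer_smul {y : Y.left} {T : Sch k} (h : T ⟶ stabilizer G y) :
    (h ≫ stabilizerElt G y) • ((h ≫ stabilizerSrc G y) ≫ ptι y) =
      (h ≫ stabilizerTgt G y) ≫ ptι y := by
  have key : pullback.fst _ _ ≫ G ◁ ptι y ≫ act G Y = pullback.snd _ _ ≫ ptι y :=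
    pullback.condition
  have e : lift (h ≫ stabilizerElt G y) ((h ≫ stabilizerSrc G y) ≫ ptι y) =
      h ≫ pullback.fst (G ◁ ptι y ≫ act G Y) (ptι y) ≫ G ◁ ptι y := by
    apply CartesianMonoidalCategory.hom_ext <;> simp [stabilizerElt, stabilizerSrc]
  have e' : (h ≫ stabilizerElt G y) • ((h ≫ stabilizerSrc G y) ≫ ptι y) =
      lift (h ≫ stabilizerElt G y) ((h ≫ stabilizerSrc G y) ≫ ptι y) ≫ act G Y := rfl
  rw [e', e, stabilizerTgt, Category.assoc, Category.assoc, Category.assoc, ← key]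

/-- The fibre `X_y = X ×_Y Spec k(y)`. -/
abbrev fibre (f : X ⟶ Y) (y : Y.left) : Sch k := pullback f (ptι y)

variable {G} in
/-- The action of `G_y` on `X_y`, on `T`-valued points: `(g, t)` sends a point `x` of `X_y` over
`t` to the point `g x` of `X_y` over `g t`. -/
def smulFibre (f : X ⟶ Y) [IsModHom G f] {y : Y.left} {T : Sch k} (h : T ⟶ stabilizer G y)
    (x : T ⟶ fibre f y) (hx : x ≫ pullback.snd f (ptι y) = h ≫ stabilizerSrc G y) :
    T ⟶ fibre f y :=
  pullback.lift ((h ≫ stabilizerElt G y) • (x ≫ pullback.fst f (ptι y)))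
    (h ≫ stabilizerTgt G y) (by
      rw [IsModHom.map_smul, Category.assoc, pullback.condition, ← Category.assoc, hx,
        stabilizer_smul])

variable {G} in
/-- The action of `G_y` on `Spec k(y) ×_k F`, on `T`-valued points: `(g, t)` sends `(t, a)` to
`(g t, g a)`. -/
def smulPtProd {F : Sch k} [ModObj G F] {y : Y.left} {T : Sch k} (h : T ⟶ stabilizer G y)
    (p : T ⟶ pt y ⊗ F) : T ⟶ pt y ⊗ F :=
  lift (h ≫ stabilizerTgt G y) ((h ≫ stabilizerElt G y) • (p ≫ snd (pt y) F))

/-- There is a `G_y`-equivariant isomorphism of `k(y)`-schemes `X_y ≅ Spec k(y) ×_k F`. -/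
def IsTrivialFibre (f : X ⟶ Y) [IsModHom G f] (F : Sch k) [ModObj G F] (y : Y.left) : Prop :=
  ∃ Φ : fibre f y ≅ pt y ⊗ F,
    Φ.hom ≫ fst (pt y) F = pullback.snd f (ptι y) ∧
    ∀ (T : Sch k) (h : T ⟶ stabilizer G y) (x : T ⟶ fibre f y)
      (hx : x ≫ pullback.snd f (ptι y) = h ≫ stabilizerSrc G y),
      smulFibre f h x hx ≫ Φ.hom = smulPtProd h (x ≫ Φ.hom)

end Fibres

end EquivariantFibration

end

/-! From (1) to (2): an immersion induces isomorphisms on residue fields, so `ptι y` factors through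
the stratum containing `y`, and the trivialization over that stratum restricts to the fibre.

For the converse, argue by Noetherian induction on invariant closed subsets of `Y`
(`exists_strata`). It suffices to trivialize `f` over a nonempty invariant open part of the reduced
subscheme `Z` on such a subset. Characteristic zero makes `G × Z` reduced, so the action restricts
to `Z`. Choose an integral affine open `V` in `Z` with generic point η. The trivialization χ of the
fibre over η and its inverse spread out after shrinking `V`, because η is the limit of its affine
neighbourhoods and all schemes involved are of finite type.

The crux is equivariance. As `V` is not invariant, one asks for χ(g x) = g χ(x) only when x and g x
both lie over `V`. This is an equality of two morphisms out of the scheme of such pairs (g, x), so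
after shrinking it is enough to know it when x lies over η. Then g x lies over a specialization of η
in the orbit of η. Such a specialization is trivial, either because the fibres of a quasi-finite
quotient are discrete or because `G` is finite (`HasDiscreteOrbits.act_eq`). Hence g lies in the
stabilizer of η, and (2) applies.

Finally, the map from `G × V` onto the open saturation of `V` is flat, surjective and locally of
finite presentation. The partial equivariance above is exactly the descent condition for (g, x) ↦ g
χ(x), so the trivialization extends to the saturation
(`PartialTrivialization.isTrivialOverStratum`). -/

noncomputable section

namespace EquivariantFibration

variable {k : Type u} [Field k]

/-! ### Products of reduced schemes in characteristic zero -/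

section Reduced

open scoped TensorProduct

/-- Reducedness of `B ⊗ M` for `M` free can be checked at the residue fields of `B`. -/
theorem isReduced_tensorProduct_of_forall_residueField {R B M : Type u} [CommRing R] [CommRing B]
    [CommRing M] [Algebra R B] [Algebra R M] [Module.Free R M] [IsReduced B]
    (h : ∀ (p : Ideal B) [p.IsPrime], IsReduced (p.ResidueField ⊗[R] M)) :
    IsReduced (B ⊗[R] M) := by
  refine ⟨fun x hx => ?_⟩
  let b := Module.Free.chooseBasis R M
  let bB := Algebra.TensorProduct.basis B b
  refine bB.repr.injective ?_
  ext i
  rw [map_zero, Finsupp.zero_apply]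
  -- A coordinate of a nilpotent element vanishes in every residue field, so it lies in every prime
  -- of the reduced ring `B`.
  refine IsNilpotent.eq_zero (nilpotent_iff_mem_prime.mpr fun p hp => ?_)
  let φ : B ⊗[R] M →ₐ[R] p.ResidueField ⊗[R] M :=
    Algebra.TensorProduct.map (Algebra.ofId B p.ResidueField |>.restrictScalars R) (AlgHom.id R M)
  have h0 : φ x = 0 := (hx.map φ).eq_zero
  have key : ∀ z : B ⊗[R] M, (Algebra.TensorProduct.basis p.ResidueField b).repr (φ z) i =
      algebraMap B p.ResidueField (bB.repr z i) := by
    intro z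
    induction z using TensorProduct.induction_on with
    | zero => simp
    | tmul a m => simp [φ, bB, Algebra.ofId_apply, Algebra.TensorProduct.basis_repr_tmul,
        ← IsScalarTower.algebraMap_apply, Algebra.smul_def]
    | add z w hz hw => simp [hz, hw]
  have := key x
  rw [h0, map_zero, Finsupp.zero_apply] at this
  rwa [eq_comm, Ideal.algebraMap_residueField_eq_zero] at this

/-- Separability makes `E → K` formally unramified, which is stable under base change to the residue
fields of `B`; over a field it forces reducedness. -/
theorem isReduced_tensorProduct_of_isSeparable {E B K : Type u} [Field E] [Field K] [CommRing B]
    [Algebra E B] [Algebra E K] [Algebra.IsSeparable E K] [Algebra.EssFiniteType E K]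
    [IsReduced B] : IsReduced (B ⊗[E] K) := by
  refine isReduced_tensorProduct_of_forall_residueField fun p _ => ?_
  have := Algebra.FormallyUnramified.of_isSeparable E K
  exact Algebra.FormallyUnramified.isReduced_of_field p.ResidueField (p.ResidueField ⊗[E] K)

/-- `E ⊗[k] L` is a localization of `A ⊗[k] L`. -/
theorem isReduced_tensorProduct_of_isFractionRing {k A E L : Type u} [Field k] [CommRing A]
    [Field E] [CommRing L] [Algebra k A] [Algebra k E] [Algebra A E] [IsScalarTower k A E]
    [IsFractionRing A E] [Algebra k L] [_root_.IsReduced (A ⊗[k] L)] : IsReduced (E ⊗[k] L) := by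
  have : _root_.IsReduced ((A ⊗[k] L) ⊗[A] E) :=
    isReduced_localizationPreserves (R := A ⊗[k] L)
      (Algebra.algebraMapSubmonoid (A ⊗[k] L) (nonZeroDivisors A)) _ inferInstance
  exact isReduced_of_injective
    ((Algebra.TensorProduct.cancelBaseChange k A A E L).symm.trans
      (Algebra.TensorProduct.comm A E (A ⊗[k] L))).toAlgHom (AlgEquiv.injective _)

theorem isReduced_tensorProduct_of_tower {k E K L : Type u} [Field k] [Field E] [Field K]
    [CommRing L] [Algebra k E] [Algebra k K] [Algebra E K] [IsScalarTower k E K] [Algebra k L]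
    [Algebra.IsSeparable E K] [Algebra.EssFiniteType E K] [_root_.IsReduced (E ⊗[k] L)] :
    IsReduced (K ⊗[k] L) := by
  have : _root_.IsReduced ((E ⊗[k] L) ⊗[E] K) := isReduced_tensorProduct_of_isSeparable
  exact isReduced_of_injective
    (((Algebra.TensorProduct.cancelBaseChange k E E K L).symm).trans
      (Algebra.TensorProduct.comm E K (E ⊗[k] L))).toAlgHom (AlgEquiv.injective _)

-- The subalgebra generated by independent elements is a polynomial ring, and stays one over the
-- field `L`; the generated field is its fraction field.
open scoped IntermediateField.algebraAdjoinAdjoin in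
theorem isReduced_tensorProduct_adjoin {k K L : Type u} [Field k] [Field K] [Field L]
    [Algebra k K] [Algebra k L] {s : Set K} (hs : AlgebraicIndependent k ((↑) : s → K)) :
    IsReduced (IntermediateField.adjoin k s ⊗[k] L) := by
  let A := Algebra.adjoin k s
  let e : MvPolynomial s k ≃ₐ[k] A :=
    hs.aevalEquiv.trans (Subalgebra.equivOfEq _ _ (by simp [A]))
  have : IsReduced (A ⊗[k] L) :=
    isReduced_of_injective
      (((Algebra.TensorProduct.comm k A L).trans
        (Algebra.TensorProduct.congr (AlgEquiv.refl (R := k) (A₁ := L)) e.symm)).trans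
        ((MvPolynomial.algebraTensorAlgEquiv k L).restrictScalars k)).toAlgHom
      (AlgEquiv.injective _)
  exact isReduced_tensorProduct_of_isFractionRing (A := A)

/-- A separating transcendence basis, available over a perfect field, splits `K / k` into a purely
transcendental step and a separable algebraic one. -/
theorem isReduced_tensorProduct_of_essFiniteType {k K L : Type u} [Field k] [PerfectField k]
    [Field K] [Field L] [Algebra k K] [Algebra k L] [Algebra.EssFiniteType k K] :
    IsReduced (L ⊗[k] K) := by
  obtain ⟨s, hs, hsep⟩ := exists_isTranscendenceBasis_and_isSeparable_of_perfectField k K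
  have : IsReduced (IntermediateField.adjoin k (s : Set K) ⊗[k] L) :=
    isReduced_tensorProduct_adjoin hs.1
  have : Algebra.EssFiniteType (IntermediateField.adjoin k (s : Set K)) K := .of_comp k _ K
  have : IsReduced (K ⊗[k] L) :=
    isReduced_tensorProduct_of_tower (E := IntermediateField.adjoin k (s : Set K))
  exact isReduced_of_injective (Algebra.TensorProduct.comm k L K).toAlgHom (AlgEquiv.injective _)

/-- Over a perfect field, reduced algebras stay reduced under arbitrary field extensions. -/
theorem isReduced_tensorProduct_of_perfectField {k K B : Type u} [Field k] [PerfectField k]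
    [Field K] [CommRing B] [Algebra k K] [Algebra k B] [IsReduced B] :
    IsReduced (B ⊗[k] K) := by
  refine isReduced_tensorProduct_of_forall_residueField fun p _ => ?_
  -- Only finitely generated subalgebras of `K` matter, and each embeds into a finitely generated
  -- field extension; flatness keeps the embedding injective.
  refine IsReduced.tensorProduct_of_flat_of_forall_fg ?_
  rintro _ ⟨s, rfl⟩
  let E := IntermediateField.adjoin k (s : Set K)
  have : Algebra.EssFiniteType k E :=
    IntermediateField.essFiniteType_iff.mpr (IntermediateField.fg_adjoin_finset s)
  have : IsReduced (p.ResidueField ⊗[k] E) := isReduced_tensorProduct_of_essFiniteType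
  let incl : Algebra.adjoin k (s : Set K) →ₐ[k] E :=
    Subalgebra.inclusion (T := E.toSubalgebra) (IntermediateField.algebra_adjoin_le_adjoin k _)
  exact isReduced_of_injective (Algebra.TensorProduct.map (AlgHom.id k p.ResidueField) incl)
    (Module.Flat.lTensor_preserves_injective_linearMap incl.toLinearMap
      (Subalgebra.inclusion_injective (IntermediateField.algebra_adjoin_le_adjoin k _)))

theorem isReduced_pullback_specMap {k K : Type u} [Field k] [PerfectField k] [Field K] [Algebra k K]
    {R : CommRingCat.{u}} [IsReduced R] (φ : CommRingCat.of k ⟶ R) :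
    IsReduced (pullback (Spec.map φ) (Spec.map (CommRingCat.ofHom (algebraMap k K)))) := by
  let : Algebra k R := φ.hom.toAlgebra
  have : _root_.IsReduced (R ⊗[k] K) := isReduced_tensorProduct_of_perfectField
  have : IsReduced (Spec (CommRingCat.of (R ⊗[k] K))) := inferInstance
  exact isReduced_of_isOpenImmersion (pullbackSpecIso k R K).hom

theorem geometricallyReduced_of_isReduced {k : Type u} [Field k] [PerfectField k] {X : Scheme.{u}}
    (f : X ⟶ Spec (.of k)) [IsReduced X] : GeometricallyReduced f := by
  refine ⟨geometrically_iff_of_commRing_of_isClosedUnderIsomorphisms.mpr fun K _ _ => ?_⟩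
  let g := Spec.map (CommRingCat.ofHom (algebraMap k K))
  have key {R : CommRingCat.{u}} (v : Spec R ⟶ X) [IsOpenImmersion v] :
      IsReduced (pullback (pullback.fst f g) v) := by
    obtain ⟨φ, hφ⟩ := Spec.map_surjective (v ≫ f)
    have : IsReduced (Spec R) := isReduced_of_isOpenImmersion v
    have : _root_.IsReduced R := (affine_isReduced_iff _).mp this
    have : IsReduced (pullback (v ≫ f) g) := by
      rw [← hφ]
      exact isReduced_pullback_specMap φ
    exact isReduced_of_isOpenImmersion
      ((pullbackSymmetry _ _).hom ≫ (pullbackRightPullbackFstIso f g v).hom)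
  exact (AlgebraicGeometry.IsReduced.iff_of_openCover _ (X.affineCover.pullback₁ (pullback.fst f g))).mpr
    fun i => have : IsOpenImmersion (X.affineOpenCover.f i) := X.affineCover.map_prop i
      key (X.affineOpenCover.f i)

/-- This is where characteristic zero enters: it lets the action descend to reduced invariant closed
subschemes. -/
theorem isReduced_tensorObj {k : Type u} [Field k] [CharZero k] (G Z : Sch k) [IsReduced G.left]
    [IsReduced Z.left] [LocallyOfFiniteType Z.hom] : IsReduced (G ⊗ Z).left := by
  have := geometricallyReduced_of_isReduced G.hom
  have : IsLocallyNoetherian Z.left := LocallyOfFiniteType.isLocallyNoetherian Z.hom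
  rw [Over.tensorObj_left]
  infer_instance

end Reduced

/-! ### Descent along flat covers -/

section Descent

theorem isPullback_whiskerLeft_snd (G : Sch k) {V Z : Sch k} (i : V ⟶ Z) :
    IsPullback (snd G V) (G ◁ i) i (snd G Z) := by
  refine ⟨⟨by simp⟩, ⟨PullbackCone.IsLimit.mk _ (fun s => lift (s.snd ≫ fst G Z) s.fst) ?_ ?_ ?_⟩⟩
  · intro s; simp
  · intro s
    ext1 <;> simp [s.condition]
  · intro s m h₁ h₂
    ext1
    · simp [← h₂]
    · simpa using h₁

theorem isPullback_whiskerRight_fst {V N : Sch k} (e : N ⟶ V) (F : Sch k) :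
    IsPullback (e ▷ F) (fst N F) (fst V F) e := by
  refine ⟨⟨by simp⟩, ⟨PullbackCone.IsLimit.mk _ (fun s => lift s.snd (s.fst ≫ snd V F)) ?_ ?_ ?_⟩⟩
  · intro s
    ext1 <;> simp [s.condition]
  · intro s; simp
  · intro s m h₁ h₂
    ext1
    · simpa using h₂
    · simp [← h₁]

/-- A flat surjective morphism of `k`-schemes, locally of finite presentation. -/
structure IsFlatCover {P A : Sch k} (π : P ⟶ A) : Prop where
  flat : Flat π.left
  surjective : Surjective π.left
  locallyOfFinitePresentation : LocallyOfFinitePresentation π.left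

theorem IsFlatCover.of_isPullback {P A Q B : Sch k} {a : Q ⟶ P} {π' : Q ⟶ B} {π : P ⟶ A}
    {b : B ⟶ A} (h : IsPullback a π' π b) (hπ : IsFlatCover π) : IsFlatCover π' := by
  have h' := h.map (Over.forget _)
  exact ⟨MorphismProperty.of_isPullback (P := @Flat) h' hπ.flat,
    MorphismProperty.of_isPullback (P := @Surjective) h' hπ.surjective,
    MorphismProperty.of_isPullback (P := @LocallyOfFinitePresentation) h'
      hπ.locallyOfFinitePresentation⟩

/-- Such covers are effective epimorphisms of schemes; compatibility with the structure morphisms to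
`Spec k` follows by cancelling the epimorphism. -/
theorem IsFlatCover.exists_desc {P A B : Sch k} {π : P ⟶ A} (hπ : IsFlatCover π) (m : P ⟶ B)
    (h : ∀ (T : Sch k) (a b : T ⟶ P), a ≫ π = b ≫ π → a ≫ m = b ≫ m) :
    ∃ M : A ⟶ B, π ≫ M = m := by
  have := hπ.flat
  have := hπ.surjective
  have := hπ.locallyOfFinitePresentation
  have hm : ∀ {Z : Scheme.{u}} (g₁ g₂ : Z ⟶ P.left), g₁ ≫ π.left = g₂ ≫ π.left →
      g₁ ≫ m.left = g₂ ≫ m.left := by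
    intro Z g₁ g₂ hg
    have hw : g₂ ≫ P.hom = g₁ ≫ P.hom := by
      rw [← Over.w π, ← Category.assoc, ← hg, Category.assoc]
    have := h (Over.mk (g₁ ≫ P.hom)) (Over.homMk g₁ rfl) (Over.homMk g₂ hw)
      (by ext1; exact hg)
    exact congrArg CommaMorphism.left this
  let M := EffectiveEpi.desc π.left m.left hm
  have hM : π.left ≫ M = m.left := EffectiveEpi.fac π.left m.left hm
  refine ⟨Over.homMk M ?_, by ext1; exact hM⟩
  rw [← cancel_epi π.left, ← Category.assoc, hM, Over.w, Over.w]

theorem IsFlatCover.epi {P A : Sch k} {π : P ⟶ A} (hπ : IsFlatCover π) : Epi π := by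
  have := hπ.flat
  have := hπ.surjective
  have := hπ.locallyOfFinitePresentation
  exact (Over.forget _).epi_of_epi_map (inferInstanceAs (Epi π.left))

theorem IsFlatCover.whiskerLeft {P A : Sch k} {π : P ⟶ A} (hπ : IsFlatCover π) (G : Sch k) :
    IsFlatCover (G ◁ π) :=
  .of_isPullback (isPullback_whiskerLeft_snd G π) hπ

end Descent

/-! ### Constructions of actions -/

section Actions

variable {G : Sch k} [GrpObj G]

/-- An action, from its effect on `T`-valued points. -/
abbrev modObjOfSMul {A : Sch k} (a : G ⊗ A ⟶ A)
    (h1 : ∀ {T : Sch k} (x : T ⟶ A), lift 1 x ≫ a = x)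
    (h2 : ∀ {T : Sch k} (g h : T ⟶ G) (x : T ⟶ A),
      lift (g * h) x ≫ a = lift g (lift h x ≫ a) ≫ a) : ModObj G A where
  smul := a
  one_smul := by
    have : (η : 𝟙_ (Sch k) ⟶ G) ▷ A = lift 1 (snd _ _) := by
      ext1
      · simp [Hom.one_def, toUnit_unique (fst (𝟙_ (Sch k)) A) (toUnit _)]
      · simp
    exact (congrArg (· ≫ a) this).trans ((h1 _).trans (leftUnitor_hom A).symm)
  mul_smul := by
    have e1 : (μ : G ⊗ G ⟶ G) ▷ A =
        lift ((fst _ _ ≫ fst G G) * (fst _ _ ≫ snd G G)) (snd (G ⊗ G) A) := by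
      ext1
      · simp [Hom.mul_def, ← comp_lift]
      · simp
    have e2 : (α_ G G A).hom ≫ G ◁ a =
        lift (fst _ _ ≫ fst G G) (lift (fst _ _ ≫ snd G G) (snd (G ⊗ G) A) ≫ a) := by
      have : (α_ G G A).hom ≫ snd _ _ = lift (fst _ _ ≫ snd G G) (snd (G ⊗ G) A) := by
        ext1 <;> simp
      ext1
      · simp
      · simp [← this]
    exact (congrArg (· ≫ a) e1).trans <| (h2 _ _ _).trans <|
      (congrArg (· ≫ a) e2.symm).trans (Category.assoc _ _ _)

/-- The restricted action on an invariant subobject. -/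
abbrev modObjOfMono {S Y : Sch k} [ModObj G Y] (j : S ⟶ Y) [Mono j] (a : G ⊗ S ⟶ S)
    (ha : a ≫ j = fst G S • (snd G S ≫ j)) : ModObj G S :=
  have key {T : Sch k} (g : T ⟶ G) (x : T ⟶ S) : (lift g x ≫ a) ≫ j = g • (x ≫ j) := by
    rw [Category.assoc, ha, ModObj.comp_smul]; simp
  modObjOfSMul a
    (fun x => by rw [← cancel_mono j, key, one_smul])
    (fun g h x => by rw [← cancel_mono j, key, key, key, mul_smul])

theorem isModHom_of_map_smul {A B : Sch k} [ModObj G A] [ModObj G B] (f : A ⟶ B)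
    (h : (fst G A • snd G A) ≫ f = fst G A • (snd G A ≫ f)) : IsModHom G f := by
  refine ⟨?_⟩
  have e1 : (fst G A • snd G A : G ⊗ A ⟶ A) = γ[G, A] := by
    rw [Hom.smul_def, lift_fst_snd, Category.id_comp]
  have e2 : (fst G A • (snd G A ≫ f) : G ⊗ A ⟶ B) = (G ◁ f) ≫ γ[G, B] := by
    rw [Hom.smul_def]
    congr 1
  rw [e1, e2] at h
  exact h

theorem isModHom_of_mono {S Y : Sch k} [ModObj G Y] (j : S ⟶ Y) [Mono j] (a : G ⊗ S ⟶ S)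
    (ha : a ≫ j = fst G S • (snd G S ≫ j)) :
    letI := modObjOfMono j a ha
    IsModHom G j := by
  let := modObjOfMono j a ha
  refine isModHom_of_map_smul j ?_
  rw [← ha, Hom.smul_def, lift_fst_snd, Category.id_comp]
  rfl

/-- The diagonal action on a product. -/
abbrev modObjProd (S F : Sch k) [ModObj G S] [ModObj G F] : ModObj G (S ⊗ F) :=
  have key {T : Sch k} (g : T ⟶ G) (x : T ⟶ S ⊗ F) :
      lift g x ≫ lift (fst G (S ⊗ F) • (snd G (S ⊗ F) ≫ fst S F))
        (fst G (S ⊗ F) • (snd G (S ⊗ F) ≫ snd S F)) =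
      lift (g • (x ≫ fst S F)) (g • (x ≫ snd S F)) := by
    rw [comp_lift, ModObj.comp_smul, ModObj.comp_smul]; simp
  modObjOfSMul _
    (fun x => by rw [key, one_smul, one_smul]; ext1 <;> simp)
    (fun g h x => by rw [key, key, key]; simp [mul_smul])

theorem modObjProd_smul {S F : Sch k} [ModObj G S] [ModObj G F] {T : Sch k} (g : T ⟶ G)
    (x : T ⟶ S ⊗ F) :
    letI := modObjProd (G := G) S F
    g • x = lift (g • (x ≫ fst S F)) (g • (x ≫ snd S F)) := by
  change lift g x ≫ lift (fst G (S ⊗ F) • (snd G (S ⊗ F) ≫ fst S F))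
        (fst G (S ⊗ F) • (snd G (S ⊗ F) ≫ snd S F)) = _
  rw [comp_lift, ModObj.comp_smul, ModObj.comp_smul]; simp

section

variable {X Y S : Sch k} [ModObj G X] [ModObj G Y] [ModObj G S] (f : X ⟶ Y)
  [IsModHom G f] (j : S ⟶ Y) [IsModHom G j] {T : Sch k} (g : T ⟶ G) (x : T ⟶ pullback f j)

@[simp]
theorem smulPullback_fst :
    smulPullback f j g x ≫ pullback.fst f j = g • (x ≫ pullback.fst f j) :=
  pullback.lift_fst _ _ _

@[simp]
theorem smulPullback_snd :
    smulPullback f j g x ≫ pullback.snd f j = g • (x ≫ pullback.snd f j) :=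
  pullback.lift_snd _ _ _

theorem comp_smulPullback {T' : Sch k} (t : T' ⟶ T) :
    t ≫ smulPullback f j g x = smulPullback f j (t ≫ g) (t ≫ x) := by
  apply pullback.hom_ext <;> simp [ModObj.comp_smul]

/-- The induced action on a fibre product. -/
abbrev modObjPullback : ModObj G (pullback f j) :=
  have key {T : Sch k} (g : T ⟶ G) (x : T ⟶ pullback f j) :
      lift g x ≫ smulPullback f j (fst G _) (snd G _) = smulPullback f j g x := by
    simp [comp_smulPullback]
  modObjOfSMul (smulPullback f j (fst G _) (snd G _))
    (fun x => by rw [key]; apply pullback.hom_ext <;> simp)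
    (fun g h x => by rw [key, key, key]; apply pullback.hom_ext <;> simp [mul_smul])

theorem modObjPullback_smul :
    letI : ModObj G (pullback f j) := modObjPullback f j
    g • x = smulPullback f j g x := by
  change lift g x ≫ smulPullback f j (fst G _) (snd G _) = smulPullback f j g x
  simp [comp_smulPullback]

end

end Actions

/-! ### Extending equivariant morphisms from a subscheme with full orbit -/

section Extension

variable {G : Sch k} [GrpObj G]

/-- The morphism `(g, w) ↦ g w`. -/
def sweep (G : Sch k) [GrpObj G] {W A : Sch k} [ModObj G A] (i : W ⟶ A) : G ⊗ W ⟶ A :=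
  fst G W • (snd G W ≫ i)

theorem lift_sweep {W A T : Sch k} [ModObj G A] (i : W ⟶ A) (g : T ⟶ G) (w : T ⟶ W) :
    lift g w ≫ sweep G i = g • (w ≫ i) := by
  simp [sweep, ModObj.comp_smul]

theorem comp_sweep {W A T : Sch k} [ModObj G A] (i : W ⟶ A) (z : T ⟶ G ⊗ W) :
    z ≫ sweep G i = (z ≫ fst G W) • (z ≫ snd G W ≫ i) := by
  simp [sweep, ModObj.comp_smul]

/-- Equivariance forces g w ↦ g m(w). This is well defined because g w = g' w' means that g'⁻¹ g
moves w to w', which is the situation covered by `hm`; flat descent then produces the morphism. -/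
theorem exists_equivariant_extension {A B W : Sch k} [ModObj G A] [ModObj G B] {i : W ⟶ A}
    (hi : IsFlatCover (sweep G i)) (m : W ⟶ B)
    (hm : ∀ (T : Sch k) (h : T ⟶ G) (w w' : T ⟶ W), h • (w ≫ i) = w' ≫ i →
      h • (w ≫ m) = w' ≫ m) :
    ∃ M : A ⟶ B, i ≫ M = m ∧ IsModHom G M := by
  obtain ⟨M, hM⟩ := hi.exists_desc (sweep G m) (by
    intro T a b hab
    rw [comp_sweep, comp_sweep] at hab ⊢
    have := hm T ((b ≫ fst G W)⁻¹ * (a ≫ fst G W)) (a ≫ snd G W) (b ≫ snd G W) (by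
      rw [mul_smul, Category.assoc, hab, inv_smul_smul, Category.assoc])
    rw [mul_smul, inv_smul_eq_iff] at this
    simpa using this)
  refine ⟨M, ?_, isModHom_of_map_smul M ?_⟩
  · have : lift 1 (𝟙 W) ≫ sweep G i ≫ M = lift 1 (𝟙 W) ≫ sweep G m := by rw [hM]
    rw [← Category.assoc, lift_sweep, lift_sweep] at this
    simpa using this
  -- Equivariance may be tested on points g (h w), where it reads (g h) m(w) = g (h m(w)).
  · have := (hi.whiskerLeft G).epi
    rw [← cancel_epi (G ◁ sweep G i)]
    have e1 : G ◁ sweep G i ≫ (fst G A • snd G A) =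
        lift (fst G _ * (snd G (G ⊗ W) ≫ fst G W)) (snd G _ ≫ snd G W) ≫ sweep G i := by
      rw [lift_sweep, ModObj.comp_smul, mul_smul]
      simp [comp_sweep]
    rw [← Category.assoc, e1, Category.assoc, hM, lift_sweep, ModObj.comp_smul, mul_smul]
    simp [hM, comp_sweep]

theorem equivariant_ext {A B W : Sch k} [ModObj G A] [ModObj G B] {i : W ⟶ A}
    (hi : IsFlatCover (sweep G i)) (M M' : A ⟶ B) [IsModHom G M] [IsModHom G M']
    (h : i ≫ M = i ≫ M') : M = M' := by
  have := hi.epi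
  rw [← cancel_epi (sweep G i), sweep, IsModHom.map_smul, IsModHom.map_smul]
  simp [h]

/-- Sweeping out is compatible with equivariant base change. -/
theorem isFlatCover_sweep_of_isPullback {U V A W : Sch k} [ModObj G U] [ModObj G A] {i : V ⟶ U}
    [Mono i] (hi : IsFlatCover (sweep G i)) {r : A ⟶ U} [IsModHom G r] {w : W ⟶ A} {s : W ⟶ V}
    (h : IsPullback s w i r) : IsFlatCover (sweep G w) := by
  have hw : Mono w := ⟨fun a b hab => h.hom_ext (by
    rw [← cancel_mono i, Category.assoc, Category.assoc, h.w, reassoc_of% hab]) hab⟩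
  refine IsFlatCover.of_isPullback (a := G ◁ s) (b := r) ?_ hi
  have hc : G ◁ s ≫ sweep G i = sweep G w ≫ r := by
    rw [comp_sweep, sweep, IsModHom.map_smul]
    simp [h.w]
  -- If g v = r(a), then g⁻¹ a lies over v, hence defines a point of `W`.
  have cond (t : PullbackCone (sweep G i) r) :
      (t.fst ≫ snd G V) ≫ i = ((t.fst ≫ fst G V)⁻¹ • t.snd) ≫ r := by
    rw [IsModHom.map_smul, ← t.condition, comp_sweep, inv_smul_smul, Category.assoc]
  refine ⟨⟨hc⟩, ⟨PullbackCone.IsLimit.mk _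
    (fun t => lift (t.fst ≫ fst G V) (h.lift _ _ (cond t))) ?_ ?_ ?_⟩⟩
  · intro t
    ext1 <;> simp
  · intro t
    simp [lift_sweep]
  · intro t m h₁ h₂
    ext1
    · simp [← h₁]
    · rw [← cancel_mono w]
      rw [comp_sweep] at h₂
      simp [← h₂, ← h₁]

end Extension

/-! ### Partial trivializations -/

section Trivialization

variable (G : Sch k) [GrpObj G] {X Y : Sch k} [ModObj G X] [ModObj G Y] (f : X ⟶ Y)
  [IsModHom G f] (F : Sch k) [ModObj G F]

/-- A trivialization of `f` over a subscheme `j : V ⟶ Y`, equivariant as far as elements of `G`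
moving points of `V` to points of `V` are concerned. -/
structure PartialTrivialization {V : Sch k} (j : V ⟶ Y) where
  /-- The second component of the trivialization. -/
  toFibre : pullback f j ⟶ F
  /-- The first component of the inverse of the trivialization. -/
  ofProd : V ⊗ F ⟶ X
  ofProd_comp : ofProd ≫ f = fst V F ≫ j
  lift_toFibre : pullback.lift ofProd (fst V F) ofProd_comp ≫ toFibre = snd V F
  lift_ofProd : lift (pullback.snd f j) toFibre ≫ ofProd = pullback.fst f j
  smul_toFibre : ∀ (T : Sch k) (g : T ⟶ G) (x x' : T ⟶ pullback f j),
    g • (x ≫ pullback.fst f j) = x' ≫ pullback.fst f j → g • (x ≫ toFibre) = x' ≫ toFibre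

variable {G f F}

/-- A partial trivialization extends to the orbit. -/
theorem PartialTrivialization.isTrivialOverStratum {U V : Sch k} [ModObj G U] (j : U ⟶ Y)
    [IsModHom G j] (i : V ⟶ U) [Mono i] (hi : IsFlatCover (sweep G i))
    (t : PartialTrivialization G f F (i ≫ j)) : IsTrivialOverStratum G f j F := by
  let : ModObj G (pullback f j) := modObjPullback f j
  let : ModObj G (U ⊗ F) := modObjProd U F
  have hfst : IsModHom G (pullback.fst f j) := isModHom_of_map_smul _ (by
    rw [modObjPullback_smul, smulPullback_fst])
  have hsnd : IsModHom G (pullback.snd f j) := isModHom_of_map_smul _ (by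
    rw [modObjPullback_smul, smulPullback_snd])
  have hfst' : IsModHom G (fst U F) := isModHom_of_map_smul _ (by rw [modObjProd_smul, lift_fst])
  have hsnd' : IsModHom G (snd U F) := isModHom_of_map_smul _ (by rw [modObjProd_smul, lift_snd])
  let a : pullback f (i ≫ j) ⟶ pullback f j :=
    pullback.lift (pullback.fst _ _) (pullback.snd _ _ ≫ i) (by simp [pullback.condition])
  have a_fst : a ≫ pullback.fst f j = pullback.fst f (i ≫ j) := pullback.lift_fst _ _ _
  have a_snd : a ≫ pullback.snd f j = pullback.snd f (i ≫ j) ≫ i := pullback.lift_snd _ _ _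
  have ha : IsPullback (pullback.snd f (i ≫ j)) a i (pullback.snd f j) := by
    refine (IsPullback.of_right (t := IsPullback.of_hasPullback f j) ?_ a_snd).flip
    rw [a_fst]
    exact IsPullback.of_hasPullback f (i ≫ j)
  have hb : IsPullback (fst V F) (i ▷ F) i (fst U F) := (isPullback_whiskerRight_fst i F).flip
  have hia := isFlatCover_sweep_of_isPullback hi ha
  have hib := isFlatCover_sweep_of_isPullback hi hb
  obtain ⟨χ, hχ, _⟩ := exists_equivariant_extension hia t.toFibre (by
    intro T h w w' hw
    refine t.smul_toFibre T h w w' ?_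
    have := congrArg (· ≫ pullback.fst f j) hw
    simpa only [IsModHom.map_smul, Category.assoc, a_fst] using this)
  obtain ⟨ω, hω, _⟩ := exists_equivariant_extension hib t.ofProd (by
    intro T h w w' hw
    have h1 := congrArg (· ≫ fst U F) hw
    have h2 := congrArg (· ≫ snd U F) hw
    simp only [IsModHom.map_smul, Category.assoc, whiskerRight_fst, whiskerRight_snd] at h1 h2
    let x : T ⟶ pullback f (i ≫ j) := w ≫ pullback.lift t.ofProd (fst V F) t.ofProd_comp
    have x_fst : x ≫ pullback.fst f (i ≫ j) = w ≫ t.ofProd := by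
      rw [Category.assoc, pullback.lift_fst]
    -- Equivariance of the inverse is deduced from that of `toFibre`: the translate of `ofProd w`
    -- has the two coordinates of `w'`, so it equals `ofProd w'`.
    let x' : T ⟶ pullback f (i ≫ j) := pullback.lift (h • (w ≫ t.ofProd)) (w' ≫ fst V F) (by
      rw [IsModHom.map_smul, Category.assoc, t.ofProd_comp, Category.assoc]
      have := congrArg (· ≫ j) h1
      simpa only [IsModHom.map_smul, Category.assoc] using this)
    have x'_fst : x' ≫ pullback.fst f (i ≫ j) = h • (w ≫ t.ofProd) := pullback.lift_fst _ _ _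
    have x'_snd : x' ≫ pullback.snd f (i ≫ j) = w' ≫ fst V F := pullback.lift_snd _ _ _
    have key := t.smul_toFibre T h x x' (by rw [x_fst, x'_fst])
    have e : x ≫ t.toFibre = w ≫ snd V F := by rw [Category.assoc, t.lift_toFibre]
    rw [e, h2] at key
    have e' : x' ≫ lift (pullback.snd f (i ≫ j)) t.toFibre = w' := by
      ext1
      · simp [x'_snd]
      · simp [key]
    rw [← x'_fst, ← t.lift_ofProd, ← Category.assoc, e'])
  have hωf : ω ≫ f = fst U F ≫ j := by
    refine equivariant_ext hib _ _ ?_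
    rw [← Category.assoc, hω, t.ofProd_comp]
    simp
  let Φ : pullback f j ⟶ U ⊗ F := lift (pullback.snd f j) χ
  let Ψ : U ⊗ F ⟶ pullback f j := pullback.lift ω (fst U F) hωf
  have Ψ_fst : Ψ ≫ pullback.fst f j = ω := pullback.lift_fst _ _ _
  have Ψ_snd : Ψ ≫ pullback.snd f j = fst U F := pullback.lift_snd _ _ _
  have hΦ : IsModHom G Φ := isModHom_of_map_smul _ (by
    rw [modObjProd_smul]; ext1 <;> simp [Φ])
  have hΨ : IsModHom G Ψ := isModHom_of_map_smul _ (by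
    rw [modObjPullback_smul]; apply pullback.hom_ext <;> simp [Ψ_fst, Ψ_snd])
  have h1 : Φ ≫ Ψ = 𝟙 _ := by
    refine equivariant_ext hia _ _ ?_
    have e : a ≫ Φ = lift (pullback.snd f (i ≫ j)) t.toFibre ≫ i ▷ F := by
      ext1 <;> simp [Φ, a_snd, hχ]
    apply pullback.hom_ext
    · rw [Category.assoc, Category.assoc, Ψ_fst, ← Category.assoc, e, Category.assoc, hω,
        t.lift_ofProd, Category.comp_id, a_fst]
    · simp [Ψ_snd, Φ]
  have h2 : Ψ ≫ Φ = 𝟙 _ := by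
    refine equivariant_ext hib _ _ ?_
    have e : i ▷ F ≫ Ψ = pullback.lift t.ofProd (fst V F) t.ofProd_comp ≫ a := by
      apply pullback.hom_ext
      · rw [Category.assoc, Category.assoc, Ψ_fst, hω, a_fst, pullback.lift_fst]
      · rw [Category.assoc, Category.assoc, Ψ_snd, a_snd, ← Category.assoc, pullback.lift_snd,
          whiskerRight_fst]
    rw [← Category.assoc, e]
    ext1
    · rw [Category.assoc, Category.assoc, lift_fst, a_snd, ← Category.assoc, pullback.lift_snd]
      simp
    · rw [Category.assoc, Category.assoc, lift_snd, hχ, t.lift_toFibre]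
      simp
  refine ⟨⟨Φ, Ψ, h1, h2⟩, lift_fst _ _, fun T g x => ?_⟩
  rw [← modObjPullback_smul, IsModHom.map_smul, modObjProd_smul]
  rfl

end Trivialization

/-! ### Spreading out from a generic point -/

section SpreadingOut

/-- Used to cancel monomorphisms: a property stable under base change passes from `f ≫ g` to `f`. -/
theorem isPullback_of_mono {C : Type*} [Category C] {A B D : C} (f : A ⟶ B) (g : B ⟶ D) [Mono g] :
    IsPullback (𝟙 A) f (f ≫ g) g :=
  ⟨⟨by simp⟩, ⟨PullbackCone.IsLimit.mk _ (fun s => s.fst) (fun s => by simp)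
    (fun s => by rw [← cancel_mono g, Category.assoc, s.condition])
    (fun s m h _ => by simpa using h)⟩⟩

/-- A morphism of schemes exhibiting its source as the generic point of an affine integral
scheme. -/
structure IsGenericInclusion {N V : Scheme.{u}} (e : N ⟶ V) : Prop where
  isAffine : IsAffine V
  isIntegral : IsIntegral V
  flat : Flat e
  mono : Mono e
  quasiCompact : QuasiCompact e
  range_eq : Set.range e = {genericPoint V}

namespace IsGenericInclusion

variable {N V : Scheme.{u}} {e : N ⟶ V}

/-- A morphism whose image is the generic point factors through its inclusion. -/
theorem exists_lift (he : IsGenericInclusion e) {S : Scheme.{u}} (t : S ⟶ V)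
    (h : ∀ x, t x = haveI := he.isIntegral; genericPoint V) :
    ∃ l : S ⟶ N, l ≫ e = t := by
  have := he.isIntegral
  have := he.flat
  have := he.mono
  have := he.quasiCompact
  have : Surjective (pullback.fst t e) := by
    refine ⟨fun x => ?_⟩
    obtain ⟨n, hn⟩ : genericPoint V ∈ Set.range e := by rw [he.range_eq]; rfl
    obtain ⟨z, hz, -⟩ := Scheme.Pullback.exists_preimage_pullback x n ((h x).trans hn.symm)
    exact ⟨z, hz⟩
  -- A flat quasi-compact surjective monomorphism is an isomorphism, so the set-theoretic hypothesis
  -- on `t` suffices even when `S` is not reduced.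
  have := Flat.isIso_of_surjective_of_mono (pullback.fst t e)
  exact ⟨inv (pullback.fst t e) ≫ pullback.snd t e, by
    rw [Category.assoc, ← pullback.condition, IsIso.inv_hom_id_assoc]⟩

theorem mem_of_nonempty (he : IsGenericInclusion e) (U : V.Opens) (hU : (U : Set V).Nonempty) (n : N) :
    e n ∈ U := by
  have := he.isIntegral
  have : e n = genericPoint V := by
    have : e n ∈ Set.range e := ⟨n, rfl⟩
    rwa [he.range_eq] at this
  rw [this]
  exact ((genericPoint_spec V).mem_open_set_iff U.isOpen).mpr (by simpa using hU)

/-- Restriction to a nonempty affine open. -/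
theorem lift_opens (he : IsGenericInclusion e) (U : V.Opens) (hU : IsAffineOpen U)
    (hU' : (U : Set V).Nonempty) :
    IsGenericInclusion (IsOpenImmersion.lift U.ι e (by
      rintro _ ⟨n, rfl⟩
      simpa using he.mem_of_nonempty U hU' n)) := by
  have := he.isIntegral
  have := he.flat
  have := he.mono
  have := he.quasiCompact
  have : Nonempty U := hU'.to_subtype
  have hr : Set.range e ⊆ Set.range U.ι := by
    rintro _ ⟨n, rfl⟩
    simpa using he.mem_of_nonempty U hU' n
  have hl := IsOpenImmersion.lift_fac U.ι e hr
  refine ⟨hU, inferInstance, ?_, mono_of_mono_fac hl, ?_, ?_⟩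
  · have : Flat (IsOpenImmersion.lift U.ι e hr ≫ U.ι) := by rwa [hl]
    exact MorphismProperty.of_isPullback (P := @Flat) (isPullback_of_mono _ U.ι) this
  · have : QuasiCompact (IsOpenImmersion.lift U.ι e hr ≫ U.ι) := by rwa [hl]
    exact QuasiCompact.of_comp _ U.ι
  · refine U.ι.isOpenEmbedding.injective.image_injective ?_
    rw [← Set.range_comp, Set.image_singleton, genericPoint_eq_of_isOpenImmersion U.ι,
      ← he.range_eq]
    exact congrArg (fun φ : N ⟶ V => Set.range φ) hl

end IsGenericInclusion

/-- Nonempty affine open subsets. -/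
abbrev NonemptyAffineOpens (V : Scheme.{u}) : Type u :=
  {U : V.Opens // IsAffineOpen U ∧ (U : Set V).Nonempty}

/-- The preimages of the nonempty affine open subsets. -/
def preimageDiagram {T V : Scheme.{u}} (p : T ⟶ V) : NonemptyAffineOpens V ⥤ Scheme.{u} where
  obj U := (p ⁻¹ᵁ U.1).toScheme
  map {U W} h := T.homOfLE (p.preimage_mono (leOfHom h))

/-- The inclusions of the preimages. -/
def preimageDiagramι {T V : Scheme.{u}} (p : T ⟶ V) :
    preimageDiagram p ⟶ (Functor.const _).obj T where
  app U := (p ⁻¹ᵁ U.1).ι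
  naturality {U W} h := by simp [preimageDiagram]

variable {N V T TN : Scheme.{u}} {e : N ⟶ V} {p : T ⟶ V}
  {a : TN ⟶ T} {b : TN ⟶ N}

theorem isCofiltered_nonemptyAffineOpens [IsAffine V] [IsIntegral V] :
    IsCofiltered (NonemptyAffineOpens V) := by
  have : Nonempty (NonemptyAffineOpens V) :=
    ⟨⊤, isAffineOpen_top V, by simp⟩
  have : IsCodirectedOrder (NonemptyAffineOpens V) :=
    ⟨fun U W => ⟨⟨U.1 ⊓ W.1, U.2.1.inf W.2.1,
      nonempty_preirreducible_inter U.1.isOpen W.1.isOpen U.2.2 W.2.2⟩,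
      (inf_le_left : U.1 ⊓ W.1 ≤ U.1), (inf_le_right : U.1 ⊓ W.1 ≤ W.1)⟩⟩
  infer_instance

theorem exists_genericLift (he : IsGenericInclusion e) (h : IsPullback a b p e)
    (U : NonemptyAffineOpens V) :
    ∃ l : TN ⟶ (preimageDiagram p).obj U, l ≫ (preimageDiagramι p).app U = a := by
  have hr : Set.range a ⊆ Set.range (p ⁻¹ᵁ U.1).ι := by
    rintro _ ⟨z, rfl⟩
    have : p (a z) = e (b z) := by
      rw [← Scheme.Hom.comp_apply, h.w, Scheme.Hom.comp_apply]
    rw [Scheme.Opens.range_ι]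
    change p (a z) ∈ U.1
    rw [this]
    exact he.mem_of_nonempty U.1 U.2.2 (b z)
  let l := IsOpenImmersion.lift (p ⁻¹ᵁ U.1).ι a hr
  exact ⟨l, IsOpenImmersion.lift_fac _ _ hr⟩

instance (U : NonemptyAffineOpens V) : Mono ((preimageDiagramι p).app U) :=
  inferInstanceAs (Mono (p ⁻¹ᵁ U.1).ι)

/-- The generic fibre maps to all preimages of nonempty opens. -/
def genericCone (he : IsGenericInclusion e) (h : IsPullback a b p e) : Cone (preimageDiagram p) where
  pt := TN
  π :=
    { app := fun U => (exists_genericLift he h U).choose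
      naturality := fun U W f => by
        rw [← cancel_mono ((preimageDiagramι p).app W), Category.assoc, Category.assoc,
          (preimageDiagramι p).naturality, (exists_genericLift he h W).choose_spec]
        simp [(exists_genericLift he h U).choose_spec] }

theorem genericCone_π_ι (he : IsGenericInclusion e) (h : IsPullback a b p e)
    (U : NonemptyAffineOpens V) :
    (genericCone he h).π.app U ≫ (preimageDiagramι p).app U = a :=
  (exists_genericLift he h U).choose_spec

theorem eq_genericPoint_of_forall_mem [IsIntegral V] {x : V}
    (h : ∀ U : NonemptyAffineOpens V, x ∈ U.1) : x = genericPoint V := by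
  refine ((genericPoint_spec V).eq ?_).symm
  rw [isGenericPoint_def, ← dense_iff_closure_eq, dense_iff_inter_open]
  rintro W hW ⟨w, hw⟩
  obtain ⟨_, ⟨U, hU, rfl⟩, hwU, hUW⟩ := V.isBasis_affineOpens.exists_subset_of_mem_open hw hW
  exact ⟨x, hUW (h ⟨U, hU, w, hwU⟩), rfl⟩

/-- A cone over the preimages maps into every nonempty affine open of `V`, hence to the generic
point alone, and therefore factors through `N`. -/
theorem nonempty_isLimit_genericCone (he : IsGenericInclusion e) (h : IsPullback a b p e) :
    Nonempty (IsLimit (genericCone he h)) := by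
  have := he.isAffine
  have := he.isIntegral
  have := he.mono
  let top : NonemptyAffineOpens V := ⟨⊤, isAffineOpen_top V, by simp⟩
  have hs (s : Cone (preimageDiagram p)) (U : NonemptyAffineOpens V) :
      s.π.app U ≫ (preimageDiagramι p).app U = s.π.app top ≫ (preimageDiagramι p).app top := by
    rw [← s.w (homOfLE (le_top : U.1 ≤ top.1) : U ⟶ top), Category.assoc,
      (preimageDiagramι p).naturality]
    simp
  have hfac (s : Cone (preimageDiagram p)) :
      ∃ l : s.pt ⟶ N, l ≫ e = (s.π.app top ≫ (preimageDiagramι p).app top) ≫ p := by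
    refine he.exists_lift _ fun x => eq_genericPoint_of_forall_mem fun U => ?_
    rw [← hs s U]
    simp only [Scheme.Hom.comp_apply]
    exact ((s.π.app U) x).2
  choose l hl using hfac
  have : Mono a := ⟨fun x y hxy => h.hom_ext hxy (by
    rw [← cancel_mono e, Category.assoc, Category.assoc, ← h.w, reassoc_of% hxy])⟩
  refine ⟨⟨fun s => h.lift _ (l s) (hl s).symm, fun s U => ?_, fun s m hm => ?_⟩⟩
  · refine (cancel_mono ((preimageDiagramι p).app U)).mp ((Category.assoc _ _ _).trans ?_)
    refine (congrArg (h.lift _ (l s) (hl s).symm ≫ ·) (genericCone_π_ι he h U)).trans ?_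
    exact (h.lift_fst _ _ (hl s).symm).trans (hs s U).symm
  · refine (cancel_mono a).mp ((Eq.trans ?_ (h.lift_fst _ _ (hl s).symm).symm))
    rw [← hm top, Category.assoc, genericCone_π_ι]
    rfl

theorem isAffineHom_preimageDiagram_map [IsAffine V] {U W : NonemptyAffineOpens V} (f : U ⟶ W) :
    IsAffineHom ((preimageDiagram p).map f) := by
  have : IsAffine U.1 := U.2.1
  have h1 : IsAffineHom U.1.ι := inferInstance
  have h2 : IsAffineHom (p ⁻¹ᵁ U.1).ι :=
    MorphismProperty.of_isPullback (P := @IsAffineHom) (isPullback_morphismRestrict p U.1) h1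
  have h3 : T.homOfLE (p.preimage_mono (leOfHom f)) ≫ (p ⁻¹ᵁ W.1).ι = (p ⁻¹ᵁ U.1).ι := by simp
  have : IsAffineHom (T.homOfLE (p.preimage_mono (leOfHom f)) ≫ (p ⁻¹ᵁ W.1).ι) := by rwa [h3]
  exact IsAffineHom.of_comp (T.homOfLE (p.preimage_mono (leOfHom f))) (p ⁻¹ᵁ W.1).ι

theorem compactSpace_preimageDiagram [QuasiCompact p] (U : NonemptyAffineOpens V) :
    CompactSpace ((preimageDiagram p).obj U) :=
  isCompact_iff_compactSpace.mp (p.isCompact_preimage U.2.1.isCompact)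

theorem quasiSeparatedSpace_preimageDiagram [QuasiSeparated p] (U : NonemptyAffineOpens V) :
    QuasiSeparatedSpace ((preimageDiagram p).obj U) :=
  have : IsAffine U.1 := U.2.1
  (quasiSeparated_iff_quasiSeparatedSpace (p ∣_ U.1)).mp inferInstance

/-- The generic fibre is a cofiltered limit of quasi-compact schemes with affine transition maps;
morphisms to a target locally of finite type that agree on the limit agree at some stage. -/
theorem exists_eq_of_genericFibre_eq [QuasiCompact p] (he : IsGenericInclusion e)
    (h : IsPullback a b p e) {S B : Scheme.{u}} (sT : T ⟶ S)
    (sB : B ⟶ S) [LocallyOfFiniteType sB] (m m' : T ⟶ B) (hm : m ≫ sB = sT) (hm' : m' ≫ sB = sT)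
    (hmm : a ≫ m = a ≫ m') :
    ∃ U : NonemptyAffineOpens V, (p ⁻¹ᵁ U.1).ι ≫ m = (p ⁻¹ᵁ U.1).ι ≫ m' := by
  have := he.isAffine
  have := he.isIntegral
  have := isCofiltered_nonemptyAffineOpens (V := V)
  obtain ⟨hlim⟩ := nonempty_isLimit_genericCone he h
  let top : NonemptyAffineOpens V := ⟨⊤, isAffineOpen_top V, by simp⟩
  have := compactSpace_preimageDiagram (p := p)
  have {U W : NonemptyAffineOpens V} (f : U ⟶ W) := isAffineHom_preimageDiagram_map (p := p) f
  obtain ⟨U, i, hU⟩ := Scheme.exists_hom_comp_eq_comp_of_locallyOfFiniteType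
    (preimageDiagram p) (preimageDiagramι p ≫ (Functor.const _).map sT) sB (genericCone he h) hlim
    (i := top) ((preimageDiagramι p).app top ≫ m) ((preimageDiagramι p).app top ≫ m')
    (by simp [hm]) (by simp [hm'])
    (by rw [← Category.assoc, ← Category.assoc, genericCone_π_ι]; exact hmm)
  refine ⟨U, ?_⟩
  rw [← Category.assoc, ← Category.assoc, (preimageDiagramι p).naturality] at hU
  simp only [Functor.const_obj_map] at hU
  exact (congrArg (· ≫ m) (Category.comp_id _)).symm.trans
    (hU.trans (congrArg (· ≫ m') (Category.comp_id _)))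

/-- The same limit argument for existence: a morphism to a target locally of finite presentation is
already defined at a finite stage. -/
theorem exists_extension_of_genericFibre [QuasiCompact p] [QuasiSeparated p]
    (he : IsGenericInclusion e) (h : IsPullback a b p e) {S B : Scheme.{u}} (sT : T ⟶ S)
    (sB : B ⟶ S) [LocallyOfFinitePresentation sB] (m : TN ⟶ B) (hm : m ≫ sB = a ≫ sT) :
    ∃ (U : NonemptyAffineOpens V) (m' : (p ⁻¹ᵁ U.1).toScheme ⟶ B),
      m' ≫ sB = (p ⁻¹ᵁ U.1).ι ≫ sT ∧
      ∀ c : TN ⟶ (p ⁻¹ᵁ U.1).toScheme, c ≫ (p ⁻¹ᵁ U.1).ι = a → c ≫ m' = m := by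
  have := he.isAffine
  have := he.isIntegral
  have := isCofiltered_nonemptyAffineOpens (V := V)
  obtain ⟨hlim⟩ := nonempty_isLimit_genericCone he h
  have := compactSpace_preimageDiagram (p := p)
  have := quasiSeparatedSpace_preimageDiagram (p := p)
  have {U W : NonemptyAffineOpens V} (f : U ⟶ W) := isAffineHom_preimageDiagram_map (p := p) f
  obtain ⟨U, m', h1, h2⟩ := Scheme.exists_π_app_comp_eq_of_locallyOfFinitePresentation
    (preimageDiagram p) (preimageDiagramι p ≫ (Functor.const _).map sT) sB (genericCone he h) hlim
    m (by
      ext U : 2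
      refine (Category.assoc _ _ _).symm.trans ?_
      rw [genericCone_π_ι]
      exact hm.symm)
  refine ⟨U, m', h2, fun c hc => ?_⟩
  rw [← h1]
  congr 1
  exact (cancel_mono ((preimageDiagramι p).app U)).mp (hc.trans (genericCone_π_ι he h U).symm)

end SpreadingOut

/-! ### Neighbourhoods of the generic point over a field -/

section Shrinking

/-- `i : V' ⟶ V` is an open immersion through which the generic inclusion `e` factors as `e'`. -/
structure IsShrinking {N V V' : Sch k} (e : N ⟶ V) (i : V' ⟶ V) (e' : N ⟶ V') : Prop where
  isGenericInclusion : IsGenericInclusion e'.left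
  isOpenImmersion : IsOpenImmersion i.left
  fac : e' ≫ i = e

theorem IsShrinking.trans {N V V' V'' : Sch k} {e : N ⟶ V} {i : V' ⟶ V} {e' : N ⟶ V'}
    {i' : V'' ⟶ V'} {e'' : N ⟶ V''} (h : IsShrinking e i e') (h' : IsShrinking e' i' e'') :
    IsShrinking e (i' ≫ i) e'' := by
  have := h.isOpenImmersion
  have := h'.isOpenImmersion
  exact ⟨h'.isGenericInclusion, by rw [Over.comp_left]; infer_instance,
    by rw [← Category.assoc, h'.fac, h.fac]⟩

theorem exists_isShrinking {N V : Sch k} {e : N ⟶ V} (he : IsGenericInclusion e.left)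
    (U : NonemptyAffineOpens V.left) :
    ∃ e' : N ⟶ Over.mk (U.1.ι ≫ V.hom), IsShrinking e (Over.homMk U.1.ι rfl) e' := by
  have hr : Set.range e.left ⊆ Set.range U.1.ι := by
    rintro _ ⟨n, rfl⟩
    simpa using he.mem_of_nonempty U.1 U.2.2 n
  have hl := IsOpenImmersion.lift_fac U.1.ι e.left hr
  refine ⟨Over.homMk (IsOpenImmersion.lift U.1.ι e.left hr) ?_, ?_, ?_, ?_⟩
  · exact (Category.assoc _ _ _).symm.trans ((congrArg (· ≫ V.hom) hl).trans (Over.w e))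
  · exact he.lift_opens U.1 U.2.1 U.2.2
  · exact inferInstanceAs (IsOpenImmersion U.1.ι)
  · ext1; exact hl

/-- Both opens contain the generic point, so an affine neighbourhood of it fits inside their
intersection. -/
theorem IsShrinking.exists_common {N V V₁ V₂ : Sch k} {e : N ⟶ V} {i₁ : V₁ ⟶ V} {e₁ : N ⟶ V₁}
    {i₂ : V₂ ⟶ V} {e₂ : N ⟶ V₂} (h₁ : IsShrinking e i₁ e₁) (h₂ : IsShrinking e i₂ e₂) :
    ∃ (V' : Sch k) (a : V' ⟶ V₁) (b : V' ⟶ V₂) (e' : N ⟶ V'),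
      IsShrinking e₁ a e' ∧ a ≫ i₁ = b ≫ i₂ := by
  have := h₂.isOpenImmersion
  have he₁ := h₁.isGenericInclusion
  have := he₁.isIntegral
  obtain ⟨n, -⟩ : genericPoint V₁.left ∈ Set.range e₁.left := by rw [he₁.range_eq]; rfl
  have hn : e₁.left n ∈ i₁.left ⁻¹ᵁ i₂.left.opensRange := by
    refine ⟨e₂.left n, ?_⟩
    rw [← Scheme.Hom.comp_apply, ← Scheme.Hom.comp_apply, ← Over.comp_left, ← Over.comp_left,
      h₁.fac, h₂.fac]
  obtain ⟨U, hU, hnU, hUle⟩ := exists_isAffineOpen_mem_and_subset hn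
  obtain ⟨e', he'⟩ := exists_isShrinking he₁ ⟨U, hU, ⟨_, hnU⟩⟩
  have hr : Set.range (U.ι ≫ i₁.left) ⊆ Set.range i₂.left := by
    rintro _ ⟨z, rfl⟩
    rw [Scheme.Hom.comp_apply]
    exact hUle z.2
  have hl := IsOpenImmersion.lift_fac i₂.left (U.ι ≫ i₁.left) hr
  have hw : IsOpenImmersion.lift i₂.left (U.ι ≫ i₁.left) hr ≫ V₂.hom = U.ι ≫ V₁.hom := by
    rw [← Over.w i₂, ← Category.assoc, hl, Category.assoc, Over.w]
  refine ⟨_, _, Over.homMk (U := Over.mk (U.ι ≫ V₁.hom)) _ hw, e', he', ?_⟩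
  ext1
  exact hl.symm

theorem range_subset_of_comp_eq {V T T' : Sch k} (p : T ⟶ V) (U : NonemptyAffineOpens V.left)
    (t : T' ⟶ T) (v : T' ⟶ Over.mk (U.1.ι ≫ V.hom)) (h : t ≫ p = v ≫ Over.homMk U.1.ι rfl) :
    Set.range t.left ⊆ Set.range (p.left ⁻¹ᵁ U.1).ι := by
  rintro _ ⟨z, rfl⟩
  rw [Scheme.Opens.range_ι]
  change p.left (t.left z) ∈ U.1
  rw [← Scheme.Hom.comp_apply, ← Over.comp_left, h]
  exact (v.left z).2

variable {N V T TN B : Sch k} {e : N ⟶ V} {p : T ⟶ V} {a : TN ⟶ T} {b : TN ⟶ N}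

/-- Quantifying over all `T'` lying over `V'` lets the result apply directly to `V' ⊗ F` and to
`pullback f (i ≫ j)`, without identifying them with open preimages. -/
theorem exists_isShrinking_eq (he : IsGenericInclusion e.left) (h : IsPullback a b p e)
    (hp : QuasiCompact p.left) (hB : LocallyOfFiniteType B.hom) (m m' : T ⟶ B)
    (hmm : a ≫ m = a ≫ m') :
    ∃ (V' : Sch k) (i : V' ⟶ V) (e' : N ⟶ V'), IsShrinking e i e' ∧
      ∀ (T' : Sch k) (t : T' ⟶ T) (v : T' ⟶ V'), t ≫ p = v ≫ i → t ≫ m = t ≫ m' := by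
  have h' : IsPullback a.left b.left p.left e.left := h.map (Over.forget _)
  obtain ⟨U, hU⟩ := exists_eq_of_genericFibre_eq he h' T.hom B.hom
    m.left m'.left (Over.w m) (Over.w m') (congrArg CommaMorphism.left hmm)
  obtain ⟨e', he'⟩ := exists_isShrinking he U
  refine ⟨_, _, e', he', fun T' t v ht => ?_⟩
  ext1
  have hl := IsOpenImmersion.lift_fac (p.left ⁻¹ᵁ U.1).ι t.left (range_subset_of_comp_eq p U t v ht)
  rw [Over.comp_left, Over.comp_left, ← hl, Category.assoc, Category.assoc]
  exact congrArg (_ ≫ ·) hU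

theorem exists_isShrinking_extension (he : IsGenericInclusion e.left) (h : IsPullback a b p e)
    (hp : QuasiCompact p.left) (hp' : QuasiSeparated p.left) (hB : LocallyOfFiniteType B.hom)
    (m : TN ⟶ B) :
    ∃ (V' : Sch k) (i : V' ⟶ V) (e' : N ⟶ V'), IsShrinking e i e' ∧
      ∀ (T' : Sch k) (t : T' ⟶ T) (v : T' ⟶ V'), t ≫ p = v ≫ i →
        ∃ m' : T' ⟶ B, ∀ c : TN ⟶ T', c ≫ t = a → c ≫ m' = m := by
  have : LocallyOfFinitePresentation B.hom :=
    LocallyOfFinitePresentation.iff_locallyOfFiniteType.mpr hB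
  have h' : IsPullback a.left b.left p.left e.left := h.map (Over.forget _)
  obtain ⟨U, m', hm', hU⟩ := exists_extension_of_genericFibre he h' T.hom B.hom
    m.left ((Over.w m).trans (Over.w a).symm)
  obtain ⟨e', he'⟩ := exists_isShrinking he U
  refine ⟨_, _, e', he', fun T' t v ht => ?_⟩
  let l := IsOpenImmersion.lift (p.left ⁻¹ᵁ U.1).ι t.left (range_subset_of_comp_eq p U t v ht)
  have hl : l ≫ (p.left ⁻¹ᵁ U.1).ι = t.left := IsOpenImmersion.lift_fac _ _ _
  refine ⟨Over.homMk (l ≫ m') ?_, fun c hc => ?_⟩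
  · rw [Category.assoc]
    refine (congrArg (l ≫ ·) hm').trans ?_
    rw [← Category.assoc, hl, Over.w]
  · ext1
    refine (Category.assoc c.left l m').symm.trans (hU _ ?_)
    rw [Category.assoc, hl, ← Over.comp_left, hc]

end Shrinking

/-! ### Quasi-compact separated schemes -/

section Finiteness

/-- Quasi-compact separated `k`-schemes. -/
structure IsQCSep (A : Sch k) : Prop where
  quasiCompact : QuasiCompact A.hom
  isSeparated : IsSeparated A.hom

variable {A B D : Sch k}

theorem IsQCSep.quasiCompact_left (hA : IsQCSep A) (hB : IsQCSep B) (f : A ⟶ B) :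
    QuasiCompact f.left := by
  have := hB.isSeparated
  have : QuasiCompact (f.left ≫ B.hom) := by rw [Over.w]; exact hA.quasiCompact
  exact QuasiCompact.of_comp _ B.hom

theorem IsQCSep.isSeparated_left (hA : IsQCSep A) (f : A ⟶ B) : IsSeparated f.left := by
  have : IsSeparated (f.left ≫ B.hom) := by rw [Over.w]; exact hA.isSeparated
  exact IsSeparated.of_comp _ B.hom

theorem IsQCSep.of_isPullback {P : Sch k} {a : P ⟶ A} {b : P ⟶ B} {f : A ⟶ D} {g : B ⟶ D}
    (h : IsPullback a b f g) (hA : IsQCSep A) (hB : IsQCSep B) (hD : IsQCSep D) : IsQCSep P := by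
  have h' := (h.map (Over.forget _)).flip
  have h1 : QuasiCompact a.left :=
    MorphismProperty.of_isPullback (P := @QuasiCompact) h' (hB.quasiCompact_left hD g)
  have h2 : IsSeparated a.left :=
    MorphismProperty.of_isPullback (P := @IsSeparated) h' (hB.isSeparated_left g)
  have := hA.quasiCompact
  have := hA.isSeparated
  have e := Over.w a
  exact ⟨by rw [← e]; infer_instance, by rw [← e]; infer_instance⟩

theorem IsQCSep.tensor (hA : IsQCSep A) (hB : IsQCSep B) : IsQCSep (A ⊗ B) := by
  have := hA.quasiCompact
  have := hA.isSeparated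
  have := hB.quasiCompact
  have := hB.isSeparated
  exact ⟨by rw [Over.tensorObj_hom]; infer_instance, by rw [Over.tensorObj_hom]; infer_instance⟩

theorem IsVariety.isQCSep (hA : IsVariety A) : IsQCSep A := ⟨hA.quasiCompact, hA.isSeparated⟩

end Finiteness

/-! ### Spreading out a trivialization of the generic fibre -/

section SpreadingOutTrivializations

theorem isPullback_pullback_of_fac {X Y V N : Sch k} {f : X ⟶ Y} {j : V ⟶ Y} {e : N ⟶ V}
    {y : N ⟶ Y} (hy : e ≫ j = y) {c : pullback f y ⟶ pullback f j}
    (h₁ : c ≫ pullback.fst f j = pullback.fst f y)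
    (h₂ : c ≫ pullback.snd f j = pullback.snd f y ≫ e) :
    IsPullback c (pullback.snd f y) (pullback.snd f j) e := by
  subst hy
  refine IsPullback.of_right (t := IsPullback.of_hasPullback f j) ?_ h₂
  rw [h₁]
  exact IsPullback.of_hasPullback f (e ≫ j)

/-- Restriction of `X ×_Y V` along `V' ⟶ V`. -/
def restrictPullback {X Y V V' : Sch k} (f : X ⟶ Y) (j : V ⟶ Y) (i : V' ⟶ V) :
    pullback f (i ≫ j) ⟶ pullback f j :=
  pullback.lift (pullback.fst _ _) (pullback.snd _ _ ≫ i) (by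
    rw [Category.assoc, pullback.condition])

section

variable {X Y V V' : Sch k} (f : X ⟶ Y) (j : V ⟶ Y) (i : V' ⟶ V)

@[simp]
theorem restrictPullback_fst :
    restrictPullback f j i ≫ pullback.fst f j = pullback.fst f (i ≫ j) :=
  pullback.lift_fst _ _ _

@[simp]
theorem restrictPullback_snd :
    restrictPullback f j i ≫ pullback.snd f j = pullback.snd f (i ≫ j) ≫ i :=
  pullback.lift_snd _ _ _

end

theorem IsGenericInclusion.isQCSep {N V : Sch k} {e : N ⟶ V} (he : IsGenericInclusion e.left) :
    IsQCSep V := by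
  have := he.isAffine
  have : IsAffineHom V.hom := inferInstance
  exact ⟨inferInstance, inferInstance⟩

variable {G : Sch k} [GrpObj G] {X Y F : Sch k} [ModObj G X] [ModObj G Y] [ModObj G F]
  {f : X ⟶ Y} [IsModHom G f] {N : Sch k} {y : N ⟶ Y}

/-- A trivialization over `V`, not yet known to be an isomorphism or equivariant, extending a
given trivialization over the generic point. -/
structure ApproxTrivialization (Φ : pullback f y ≅ N ⊗ F) {V : Sch k} (e : N ⟶ V) (j : V ⟶ Y) where
  toFibre : pullback f j ⟶ F
  ofProd : V ⊗ F ⟶ X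
  toFibre_generic : ∀ c : pullback f y ⟶ pullback f j, c ≫ pullback.fst f j = pullback.fst f y →
    c ≫ pullback.snd f j = pullback.snd f y ≫ e → c ≫ toFibre = Φ.hom ≫ snd N F
  ofProd_generic : e ▷ F ≫ ofProd = Φ.inv ≫ pullback.fst f y
  ofProd_comp : ofProd ≫ f = fst V F ≫ j

theorem exists_approxTrivialization {V : Sch k} {e : N ⟶ V} {j : V ⟶ Y} (hy : e ≫ j = y)
    (he : IsGenericInclusion e.left) (hX : IsVariety X) (hY : IsVariety Y) (hF : IsVariety F)
    (Φ : pullback f y ≅ N ⊗ F) (hΦ : Φ.hom ≫ fst N F = pullback.snd f y) :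
    ∃ (V' : Sch k) (i : V' ⟶ V) (e' : N ⟶ V'), IsShrinking e i e' ∧
      Nonempty (ApproxTrivialization Φ e' (i ≫ j)) := by
  have hΦ' : Φ.inv ≫ pullback.snd f y = fst N F := by rw [Iso.inv_comp_eq, hΦ]
  let c : pullback f y ⟶ pullback f j :=
    pullback.lift (pullback.fst f y) (pullback.snd f y ≫ e) (by
      rw [Category.assoc, hy, pullback.condition])
  have c_fst : c ≫ pullback.fst f j = pullback.fst f y := pullback.lift_fst _ _ _
  have c_snd : c ≫ pullback.snd f j = pullback.snd f y ≫ e := pullback.lift_snd _ _ _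
  have hT : IsQCSep (pullback f j) :=
    .of_isPullback (IsPullback.of_hasPullback f j) hX.isQCSep he.isQCSep hY.isQCSep
  have : IsSeparated (pullback.snd f j).left := hT.isSeparated_left _
  obtain ⟨V₁, i₁, e₁, h₁, hφ⟩ := exists_isShrinking_extension he
    (isPullback_pullback_of_fac hy c_fst c_snd) (hT.quasiCompact_left he.isQCSep _)
    inferInstance hF.locallyOfFiniteType (Φ.hom ≫ snd N F)
  have he₁ := h₁.isGenericInclusion
  have hT' : IsQCSep (V₁ ⊗ F) := he₁.isQCSep.tensor hF.isQCSep
  have : IsSeparated (fst V₁ F).left := hT'.isSeparated_left _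
  obtain ⟨V₂, i₂, e₂, h₂, hψ⟩ := exists_isShrinking_extension he₁
    (isPullback_whiskerRight_fst e₁ F) (hT'.quasiCompact_left he₁.isQCSep _)
    inferInstance hX.locallyOfFiniteType (Φ.inv ≫ pullback.fst f y)
  obtain ⟨ψ, hψ⟩ := hψ (V₂ ⊗ F) (i₂ ▷ F) (fst V₂ F) (by simp)
  have hψ' : e₂ ▷ F ≫ ψ = Φ.inv ≫ pullback.fst f y :=
    hψ (e₂ ▷ F) (by rw [← comp_whiskerRight, h₂.fac])
  have he₂ := h₂.isGenericInclusion
  have hT'' : IsQCSep (V₂ ⊗ F) := he₂.isQCSep.tensor hF.isQCSep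
  have h₁₂ := h₁.trans h₂
  -- The extended inverse need not be a morphism over `Y`, but it is one on the generic fibre, so a
  -- further shrinking repairs this.
  obtain ⟨V₃, i₃, e₃, h₃, heq⟩ := exists_isShrinking_eq he₂
    (isPullback_whiskerRight_fst e₂ F) (hT''.quasiCompact_left he₂.isQCSep _)
    hY.locallyOfFiniteType (ψ ≫ f) (fst V₂ F ≫ (i₂ ≫ i₁) ≫ j) (by
      rw [← Category.assoc, hψ', Category.assoc, pullback.condition, ← Category.assoc, hΦ',
        whiskerRight_fst_assoc, ← Category.assoc e₂, h₁₂.fac, hy])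
  have h₁₃ := h₁₂.trans h₃
  obtain ⟨φ, hφ⟩ := hφ (pullback f ((i₃ ≫ i₂ ≫ i₁) ≫ j)) (restrictPullback f j (i₃ ≫ i₂ ≫ i₁))
    (pullback.snd _ _ ≫ i₃ ≫ i₂) (by simp)
  refine ⟨V₃, i₃ ≫ i₂ ≫ i₁, e₃, h₁₃, ⟨φ, i₃ ▷ F ≫ ψ, ?_, ?_, ?_⟩⟩
  · intro c' h h'
    refine hφ c' ?_
    apply pullback.hom_ext
    · rw [Category.assoc, restrictPullback_fst, h, c_fst]
    · rw [Category.assoc, restrictPullback_snd, reassoc_of% h', c_snd, h₁₃.fac]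
  · rw [← Category.assoc, ← comp_whiskerRight, h₃.fac, hψ']
  · rw [Category.assoc, heq (V₃ ⊗ F) (i₃ ▷ F) (fst V₃ F) (by simp)]
    simp

/-- By `horb`, a translate of a point over the generic point that stays over `V` is again over the
generic point. Both points then come from the generic fibre, where `hequiv` applies. -/
theorem ApproxTrivialization.smul_toFibre_generic {V : Sch k} {e : N ⟶ V} {j : V ⟶ Y}
    (hy : e ≫ j = y) {Φ : pullback f y ≅ N ⊗ F} (t : ApproxTrivialization Φ e j)
    (hequiv : ∀ (T : Sch k) (g : T ⟶ G) (x x' : T ⟶ pullback f y),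
      g • (x ≫ pullback.fst f y) = x' ≫ pullback.fst f y →
      g • (x ≫ Φ.hom ≫ snd N F) = x' ≫ Φ.hom ≫ snd N F)
    (horb : ∀ (T : Sch k) (g : T ⟶ G) (n : T ⟶ N) (v : T ⟶ V), g • (n ≫ y) = v ≫ j →
      ∃ n' : T ⟶ N, n' ≫ e = v)
    (T : Sch k) (g : T ⟶ G) (x x' : T ⟶ pullback f j) (b : T ⟶ N)
    (hx : g • (x ≫ pullback.fst f j) = x' ≫ pullback.fst f j)
    (hb : x ≫ pullback.snd f j = b ≫ e) : g • (x ≫ t.toFibre) = x' ≫ t.toFibre := by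
  subst hy
  obtain ⟨n', hn'⟩ := horb _ g b (x' ≫ pullback.snd f j) (by
    have := congrArg (· ≫ f) hx
    simp only [IsModHom.map_smul, Category.assoc] at this
    rwa [pullback.condition, ← Category.assoc, hb, Category.assoc, ← Category.assoc] at this)
  let c := restrictPullback f j e
  have c_fst : c ≫ pullback.fst f j = pullback.fst f (e ≫ j) := restrictPullback_fst f j e
  have c_snd : c ≫ pullback.snd f j = pullback.snd f (e ≫ j) ≫ e := restrictPullback_snd f j e
  have hc := t.toFibre_generic c c_fst c_snd
  have hfac (x : T ⟶ pullback f j) (b : T ⟶ N) (hb : x ≫ pullback.snd f j = b ≫ e) :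
      ∃ z, z ≫ c = x := by
    have w : (x ≫ pullback.fst f j) ≫ f = b ≫ e ≫ j := by
      rw [Category.assoc, pullback.condition, ← Category.assoc, hb, Category.assoc]
    refine ⟨pullback.lift _ _ w, ?_⟩
    apply pullback.hom_ext
    · rw [Category.assoc, c_fst, pullback.lift_fst]
    · rw [Category.assoc, c_snd, ← Category.assoc, pullback.lift_snd, hb]
  obtain ⟨z, rfl⟩ := hfac x b hb
  obtain ⟨z', rfl⟩ := hfac x' n' hn'.symm
  rw [Category.assoc, Category.assoc, hc]
  refine hequiv T g z z' ?_
  rwa [Category.assoc, Category.assoc, c_fst] at hx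

theorem ApproxTrivialization.exists_partialTrivialization {V : Sch k} {e : N ⟶ V} {j : V ⟶ Y}
    (hy : e ≫ j = y) (he : IsGenericInclusion e.left) (hG : IsVariety G)
    (hX : IsVariety X) (hY : IsVariety Y) (hF : IsVariety F)
    {Φ : pullback f y ≅ N ⊗ F} (hΦ : Φ.hom ≫ fst N F = pullback.snd f y)
    (t : ApproxTrivialization Φ e j)
    (hequiv : ∀ (T : Sch k) (g : T ⟶ G) (x x' : T ⟶ pullback f y),
      g • (x ≫ pullback.fst f y) = x' ≫ pullback.fst f y →
      g • (x ≫ Φ.hom ≫ snd N F) = x' ≫ Φ.hom ≫ snd N F)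
    (horb : ∀ (T : Sch k) (g : T ⟶ G) (n : T ⟶ N) (v : T ⟶ V), g • (n ≫ y) = v ≫ j →
      ∃ n' : T ⟶ N, n' ≫ e = v) :
    ∃ (V' : Sch k) (i : V' ⟶ V) (e' : N ⟶ V'), IsShrinking e i e' ∧
      Nonempty (PartialTrivialization G f F (i ≫ j)) := by
  have hΦ' : Φ.inv ≫ pullback.snd f y = fst N F := by rw [Iso.inv_comp_eq, hΦ]
  let c : pullback f y ⟶ pullback f j :=
    pullback.lift (pullback.fst f y) (pullback.snd f y ≫ e) (by
      rw [Category.assoc, hy, pullback.condition])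
  have c_fst : c ≫ pullback.fst f j = pullback.fst f y := pullback.lift_fst _ _ _
  have c_snd : c ≫ pullback.snd f j = pullback.snd f y ≫ e := pullback.lift_snd _ _ _
  have c_toFibre := t.toFibre_generic c c_fst c_snd
  have hXV : IsQCSep (pullback f j) :=
    .of_isPullback (IsPullback.of_hasPullback f j) hX.isQCSep he.isQCSep hY.isQCSep
  have hVF : IsQCSep (V ⊗ F) := he.isQCSep.tensor hF.isQCSep
  -- the two composites are identities over a neighbourhood of the generic point
  let d : V ⊗ F ⟶ pullback f j := pullback.lift t.ofProd (fst V F) t.ofProd_comp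
  have d_fst : d ≫ pullback.fst f j = t.ofProd := pullback.lift_fst _ _ _
  have d_snd : d ≫ pullback.snd f j = fst V F := pullback.lift_snd _ _ _
  have hd : e ▷ F ≫ d = Φ.inv ≫ c := by
    apply pullback.hom_ext
    · rw [Category.assoc, d_fst, t.ofProd_generic, Category.assoc, c_fst]
    · rw [Category.assoc, d_snd, Category.assoc, c_snd, ← Category.assoc, hΦ', whiskerRight_fst]
  have hc : c ≫ lift (pullback.snd f j) t.toFibre = Φ.hom ≫ e ▷ F := by
    ext1
    · simp [c_snd, reassoc_of% hΦ]
    · simp [c_toFibre]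
  obtain ⟨V₁, i₁, e₁, h₁, heq₁⟩ := exists_isShrinking_eq he (isPullback_whiskerRight_fst e F)
    (hVF.quasiCompact_left he.isQCSep _) hF.locallyOfFiniteType (d ≫ t.toFibre) (snd V F) (by
      rw [← Category.assoc, hd, Category.assoc, c_toFibre]; simp)
  obtain ⟨V₂, i₂, e₂, h₂, heq₂⟩ := exists_isShrinking_eq he (isPullback_pullback_of_fac hy c_fst c_snd)
    (hXV.quasiCompact_left he.isQCSep _) hX.locallyOfFiniteType
    (lift (pullback.snd f j) t.toFibre ≫ t.ofProd) (pullback.fst f j) (by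
      rw [← Category.assoc, hc, Category.assoc, t.ofProd_generic, Iso.hom_inv_id_assoc, c_fst])
  -- equivariance holds over a neighbourhood of the generic point
  let P := pullback (sweep G (pullback.fst f j)) (pullback.fst f j)
  let g : P ⟶ G := pullback.fst _ _ ≫ fst _ _
  let x : P ⟶ pullback f j := pullback.fst _ _ ≫ snd _ _
  let x' : P ⟶ pullback f j := pullback.snd _ _
  have hx : g • (x ≫ pullback.fst f j) = x' ≫ pullback.fst f j := by
    refine Eq.trans ?_ pullback.condition
    rw [comp_sweep, Category.assoc]
  have hax (T : Sch k) (a : T ⟶ P) :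
      (a ≫ g) • ((a ≫ x) ≫ pullback.fst f j) = (a ≫ x') ≫ pullback.fst f j := by
    rw [Category.assoc a x, Category.assoc a x', ← hx, ModObj.comp_smul]
  have hP : IsQCSep P :=
    .of_isPullback (IsPullback.of_hasPullback _ _) (hG.isQCSep.tensor hXV) hXV hX.isQCSep
  -- `P` is the universal scheme of triples (g, x, x') with g x = x', viewed over `V` through x.
  -- Equivariance is one equality of morphisms `P ⟶ F`, known on the generic fibre.
  obtain ⟨V₃, i₃, e₃, h₃, heq₃⟩ := exists_isShrinking_eq he
    (IsPullback.of_hasPullback (x ≫ pullback.snd f j) e)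
    (hP.quasiCompact_left he.isQCSep _) hF.locallyOfFiniteType
    (g • (x ≫ t.toFibre)) (x' ≫ t.toFibre) (by
      have hxb := pullback.condition (f := x ≫ pullback.snd f j) (g := e)
      rw [← Category.assoc] at hxb
      refine Eq.trans ?_ ((t.smul_toFibre_generic hy hequiv horb _ _ _ _ _ (hax _ _) hxb).trans ?_)
      · rw [ModObj.comp_smul, Category.assoc _ x]
      · rw [Category.assoc _ x'])
  -- The two inverse laws and equivariance hold over three different neighbourhoods; pass to one
  -- lying in all of them.
  obtain ⟨V₄, i₄, i₅, e₄, h₄, h₄₅⟩ := h₁.exists_common h₂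
  obtain ⟨V₅, i₆, i₇, e₅, h₅, h₆₇⟩ := (h₁.trans h₄).exists_common h₃
  have hs := (h₁.trans h₄).trans h₅
  have hi₁ : i₆ ≫ i₄ ≫ i₁ = (i₆ ≫ i₄) ≫ i₁ := (Category.assoc _ _ _).symm
  have hi₂ : i₆ ≫ i₄ ≫ i₁ = (i₆ ≫ i₅) ≫ i₂ := by simp only [h₄₅, Category.assoc]
  generalize i₆ ≫ i₄ ≫ i₁ = i at hs h₆₇ hi₁ hi₂
  let r := restrictPullback f j i
  have r_fst : r ≫ pullback.fst f j = pullback.fst f (i ≫ j) := restrictPullback_fst f j i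
  have r_snd : r ≫ pullback.snd f j = pullback.snd f (i ≫ j) ≫ i := restrictPullback_snd f j i
  have hcomp : (i ▷ F ≫ t.ofProd) ≫ f = fst V₅ F ≫ i ≫ j := by
    rw [Category.assoc, t.ofProd_comp, whiskerRight_fst_assoc]
  refine ⟨V₅, i, e₅, hs, ⟨⟨r ≫ t.toFibre, i ▷ F ≫ t.ofProd, hcomp, ?_, ?_, ?_⟩⟩⟩
  · have : pullback.lift (i ▷ F ≫ t.ofProd) (fst V₅ F) hcomp ≫ r = i ▷ F ≫ d := by
      apply pullback.hom_ext
      · rw [Category.assoc, r_fst, pullback.lift_fst, Category.assoc, d_fst]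
      · rw [Category.assoc, r_snd, ← Category.assoc, pullback.lift_snd, Category.assoc, d_snd,
          whiskerRight_fst]
    rw [reassoc_of% this, heq₁ (V₅ ⊗ F) (i ▷ F) (fst V₅ F ≫ i₆ ≫ i₄) (by
      rw [whiskerRight_fst, Category.assoc, ← hi₁]), whiskerRight_snd]
  · have : lift (pullback.snd f (i ≫ j)) (r ≫ t.toFibre) ≫ i ▷ F =
        r ≫ lift (pullback.snd f j) t.toFibre := by
      ext1
      · simp [r_snd]
      · simp
    rw [reassoc_of% this, heq₂ _ r (pullback.snd f (i ≫ j) ≫ i₆ ≫ i₅) (by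
      rw [r_snd, Category.assoc, ← hi₂]), r_fst]
  · intro T h w w' hw
    let l : T ⟶ P := pullback.lift (lift h (w ≫ r)) (w' ≫ r) (by
      rw [lift_sweep, Category.assoc w, r_fst, Category.assoc, r_fst, hw])
    have l_fst : l ≫ pullback.fst _ _ = lift h (w ≫ r) := pullback.lift_fst _ _ _
    have lg : l ≫ g = h := by rw [← Category.assoc, l_fst, lift_fst]
    have lx : l ≫ x = w ≫ r := by rw [← Category.assoc, l_fst, lift_snd]
    have lx' : l ≫ x' = w' ≫ r := pullback.lift_snd _ _ _
    have := heq₃ T l (w ≫ pullback.snd f (i ≫ j) ≫ i₇) (by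
      rw [reassoc_of% lx, r_snd, Category.assoc, Category.assoc, ← h₆₇])
    rw [ModObj.comp_smul, lg, reassoc_of% lx, reassoc_of% lx'] at this
    simpa only [Category.assoc] using this

end SpreadingOutTrivializations

/-! ### Generic points -/

section GenericPoint

instance flat_fromSpecStalk (X : Scheme.{u}) (x : X) : Flat (X.fromSpecStalk x) := by
  obtain ⟨U, hU, hxU, -⟩ := exists_isAffineOpen_mem_and_subset (x := x) (U := ⊤) trivial
  rw [← hU.fromSpecStalk_eq_fromSpecStalk hxU]
  have : Flat (Spec.map (X.presheaf.germ U x hxU)) := by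
    let : Algebra Γ(X, U) (X.presheaf.stalk x) := (X.presheaf.germ U x hxU).hom.toAlgebra
    have := hU.isLocalization_stalk ⟨x, hxU⟩
    rw [Flat.SpecMap_iff]
    exact IsLocalization.flat (X.presheaf.stalk x) (hU.primeIdealOf ⟨x, hxU⟩).asIdeal.primeCompl
  exact inferInstanceAs (Flat (Spec.map (X.presheaf.germ U x hxU) ≫ hU.fromSpec))

/-- At the generic point of an integral scheme the stalk is already the residue field, so flatness
is inherited from the stalk. -/
theorem isGenericInclusion_fromSpecResidueField (V : Scheme.{u}) [IsAffine V] [IsIntegral V] :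
    IsGenericInclusion (V.fromSpecResidueField (genericPoint V)) := by
  have h : Function.Bijective (V.residue (genericPoint V)) :=
    ⟨(show V.functionField →+* V.residueField (genericPoint V) from (V.residue (genericPoint V)).hom).injective,
      V.residue_surjective _⟩
  have : IsIso (V.residue (genericPoint V)) := (ConcreteCategory.isIso_iff_bijective _).mpr h
  refine ⟨inferInstance, inferInstance, ?_, inferInstance, inferInstance,
    Scheme.range_fromSpecResidueField _⟩
  rw [Scheme.fromSpecResidueField]
  infer_instance

theorem isIso_SpecMap_residueFieldMap {S Y : Scheme.{u}} (i : S ⟶ Y) [SurjectiveOnStalks i]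
    (s : S) : IsIso (Spec.map (i.residueFieldMap s)) := by
  suffices IsIso (i.residueFieldMap s) by infer_instance
  rw [ConcreteCategory.isIso_iff_bijective]
  refine ⟨RingHom.injective (i.residueFieldMap s).hom, ?_⟩
  refine Function.Surjective.of_comp (g := Y.residue (i s)) ?_
  have := (S.residue_surjective s).comp (i.stalkMap_surjective s)
  convert this using 1
  ext z
  exact congr($(Scheme.residue_residueFieldMap i s) z)

/-- Surjectivity on stalks makes the residue field extension trivial. This transports hypotheses at
points of `Y` to points of its subschemes and back. -/
theorem exists_ptIso {S Y : Sch k} (i : S ⟶ Y) [SurjectiveOnStalks i.left] (s : S.left) :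
    ∃ φ : pt (i.left s) ≅ pt s, φ.hom ≫ ptι s ≫ i = ptι (i.left s) := by
  have := isIso_SpecMap_residueFieldMap i.left s
  have h := Scheme.Hom.SpecMap_residueFieldMap_fromSpecResidueField i.left s
  let e := asIso (Spec.map (i.left.residueFieldMap s))
  let ψ : pt s ≅ pt (i.left s) := Over.isoMk e (by
    change Spec.map (i.left.residueFieldMap s) ≫ Y.left.fromSpecResidueField _ ≫ Y.hom =
      S.left.fromSpecResidueField s ≫ S.hom
    rw [← Category.assoc, h, Category.assoc, Over.w])
  refine ⟨ψ.symm, ?_⟩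
  rw [Iso.symm_hom, Iso.inv_comp_eq]
  exact Over.OverMorphism.ext h.symm

theorem exists_irreducible_open (Z : Type*) [TopologicalSpace Z]
    [TopologicalSpace.NoetherianSpace Z] [Nonempty Z] : ∃ U : TopologicalSpace.Opens Z, IsIrreducible (U : Set Z) := by
  obtain ⟨z⟩ := ‹Nonempty Z›
  obtain ⟨o, ho, hne, hle⟩ := TopologicalSpace.NoetherianSpace.exists_isOpen_nonempty_subset_irreducibleComponent
    (irreducibleComponent z) (irreducibleComponent_mem_irreducibleComponents z)
  refine ⟨⟨o, ho⟩, hne, ?_⟩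
  exact isIrreducible_irreducibleComponent.2.open_subset ho hle

theorem exists_integral_affine_open (Z : Scheme.{u}) [IsReduced Z]
    [TopologicalSpace.NoetherianSpace Z]
    [Nonempty Z] : ∃ V : Z.Opens, IsAffineOpen V ∧ IsIntegral V := by
  obtain ⟨U, ⟨x, hx⟩, hU⟩ := exists_irreducible_open Z
  obtain ⟨V, hV, hxV, hVU⟩ := exists_isAffineOpen_mem_and_subset (x := x) (U := U) hx
  have : IrreducibleSpace V := by
    have h : IsIrreducible (V : Set Z) := ⟨⟨x, hxV⟩, hU.open_subset V.isOpen hVU⟩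
    exact Subtype.irreducibleSpace h
  refine ⟨V, hV, ?_⟩
  exact isIntegral_of_irreducibleSpace_of_isReduced V

end GenericPoint

theorem isOpenImmersion_whiskerLeft (G : Sch k) {V Z : Sch k} (i : V ⟶ Z) [IsOpenImmersion i.left] :
    IsOpenImmersion (G ◁ i).left := by
  have h' := (isPullback_whiskerLeft_snd G i).map (Over.forget _)
  exact MorphismProperty.of_isPullback (P := @IsOpenImmersion) h' ‹_›

theorem flat_snd (G Z : Sch k) : Flat (snd G Z).left := by
  rw [Over.snd_left]
  infer_instance

/-! ### Discreteness of orbits -/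

section OrbitOfGenericPoint

variable {G : Sch k} [GrpObj G] {Z : Sch k} [ModObj G Z]

theorem comp_act {T : Sch k} (g : T ⟶ G) (z : T ⟶ Z) : lift g z ≫ act G Z = g • z := rfl

theorem sweep_eq {V : Sch k} (i : V ⟶ Z) : sweep G i = G ◁ i ≫ act G Z := by
  rw [sweep, ← comp_act]
  congr 1

variable (G Z) in
/-- The automorphism `(g, z) ↦ (g⁻¹, g z)` of `G × Z`. -/
def shear : G ⊗ Z ⟶ G ⊗ Z := lift (fst G Z)⁻¹ (act G Z)

variable (G Z) in
@[simp]
theorem shear_snd : shear G Z ≫ snd G Z = act G Z := lift_snd _ _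

variable (G Z) in
@[simp]
theorem shear_fst : shear G Z ≫ fst G Z = (fst G Z)⁻¹ := lift_fst _ _

variable (G Z) in
@[simp]
theorem shear_act : shear G Z ≫ act G Z = snd G Z := by
  have h : act G Z = fst G Z • snd G Z := by rw [← comp_act, lift_fst_snd, Category.id_comp]
  rw [shear, comp_act, h, inv_smul_smul]

variable (G Z) in
@[simp]
theorem shear_shear : shear G Z ≫ shear G Z = 𝟙 (G ⊗ Z) := by
  ext1
  · rw [Category.assoc, shear_fst, GrpObj.comp_inv, shear_fst, inv_inv, Category.id_comp]
  · rw [Category.assoc, shear_snd, shear_act, Category.id_comp]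

instance isIso_shear : IsIso (shear G Z) := ⟨shear G Z, shear_shear G Z, shear_shear G Z⟩

instance isIso_shear_left : IsIso (shear G Z).left :=
  inferInstanceAs (IsIso ((Over.forget _).map (shear G Z)))

/-- The action is the projection precomposed with the automorphism `shear`. -/
theorem flat_act : Flat (act G Z).left := by
  have := flat_snd G Z
  rw [← shear_snd, Over.comp_left]
  infer_instance

theorem locallyOfFinitePresentation_act (hG : LocallyOfFiniteType G.hom) :
    LocallyOfFinitePresentation (act G Z).left := by
  have : LocallyOfFinitePresentation G.hom :=
    LocallyOfFinitePresentation.iff_locallyOfFiniteType.mpr hG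
  have : LocallyOfFinitePresentation (snd G Z).left := by
    rw [Over.snd_left]
    infer_instance
  rw [← shear_snd, Over.comp_left]
  infer_instance

theorem eq_of_specializes_of_locallyQuasiFinite {A B : Scheme.{u}} (f : A ⟶ B)
    [LocallyQuasiFinite f] {a b : A} (h : a ⤳ b) (hab : f a = f b) : a = b := by
  have := (f.isDiscrete_preimage_singleton (f b)).to_subtype
  have h' : (⟨a, hab⟩ : f ⁻¹' {f b}) ⤳ ⟨b, rfl⟩ := Topology.IsInducing.subtypeVal.specializes_iff.mp h
  exact congrArg Subtype.val h'.eq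

variable (G Z) in
/-- Orbits are discrete, either because there is an invariant morphism with discrete fibres, or
because the group is finite. -/
def HasDiscreteOrbits : Prop :=
  (∃ (Q : Sch k) (q : Z ⟶ Q), act G Z ≫ q = snd G Z ≫ q ∧ LocallyQuasiFinite q.left) ∨
    IsFinite G.hom

/-- With an invariant quasi-finite map, both points lie in one discrete fibre. With `G` finite,
flatness of the action lifts the generalization to some z' ⤳ z; by maximality z' and z have the same
second projection, and discreteness of its fibres gives z' = z. -/
theorem HasDiscreteOrbits.act_eq (hZ : HasDiscreteOrbits G Z) (z : (G ⊗ Z : Sch k).left)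
    (hmax : ∀ w : Z.left, w ⤳ (snd G Z).left z → w = (snd G Z).left z)
    (hz : (snd G Z).left z ⤳ (act G Z).left z) : (act G Z).left z = (snd G Z).left z := by
  obtain ⟨Q, q, hq, _⟩ | hG := hZ
  · refine (eq_of_specializes_of_locallyQuasiFinite q.left hz ?_).symm
    rw [← Scheme.Hom.comp_apply, ← Scheme.Hom.comp_apply, ← Over.comp_left, ← Over.comp_left, hq]
  · have := flat_act (G := G) (Z := Z)
    have : LocallyQuasiFinite (snd G Z).left := by
      rw [Over.snd_left]
      infer_instance
    obtain ⟨z', hz', h⟩ := Flat.generalizingMap (act G Z).left hz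
    have h' := hmax _ (hz'.map (snd G Z).left.continuous)
    rw [← eq_of_specializes_of_locallyQuasiFinite (snd G Z).left hz' h', h, h']

theorem HasDiscreteOrbits.exists_lift (hZ : HasDiscreteOrbits G Z) {N V : Sch k} {e : N ⟶ V}
    (he : IsGenericInclusion e.left) (i : V ⟶ Z) [IsOpenImmersion i.left] {T : Sch k} (g : T ⟶ G)
    (n : T ⟶ N) (v : T ⟶ V) (h : g • (n ≫ e ≫ i) = v ≫ i) : ∃ n' : T ⟶ N, n' ≫ e = v := by
  have := he.isIntegral
  obtain ⟨l, hl⟩ := he.exists_lift v.left (fun x => by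
    have hn : (n ≫ e).left x = genericPoint V.left := by
      have : (n ≫ e).left x ∈ Set.range e.left := ⟨n.left x, by
        rw [← Scheme.Hom.comp_apply, ← Over.comp_left]⟩
      rwa [he.range_eq] at this
    let z : (G ⊗ Z : Sch k).left := (lift g (n ≫ e ≫ i)).left x
    have hs : (snd G Z).left z = i.left (genericPoint V.left) := by
      rw [← hn, ← Scheme.Hom.comp_apply, ← Scheme.Hom.comp_apply, ← Over.comp_left,
        ← Over.comp_left, lift_snd, Category.assoc]
    have ha : (act G Z).left z = i.left (v.left x) := by
      rw [← Scheme.Hom.comp_apply, ← Scheme.Hom.comp_apply, ← Over.comp_left,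
        ← Over.comp_left, comp_act, h]
    -- Since `V` is open in `Z`, its generic point has no proper generalization in `Z`.
    have := hZ.act_eq z (fun w hw => by
      rw [hs] at hw ⊢
      obtain ⟨w, rfl⟩ := hw.mem_open i.left.isOpenEmbedding.isOpen_range ⟨_, rfl⟩
      have hw' := i.left.isOpenEmbedding.isInducing.specializes_iff.mp hw
      rw [(hw'.antisymm ((genericPoint_spec _).specializes trivial)).eq]) (by
      rw [hs, ha]
      exact ((genericPoint_spec V.left).specializes trivial).map i.left.continuous)
    rw [hs, ha] at this
    exact i.left.isOpenEmbedding.injective this)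
  refine ⟨Over.homMk l ?_, ?_⟩
  · rw [← Over.w e, ← Category.assoc, hl, Over.w]
  · exact Over.OverMorphism.ext hl

end OrbitOfGenericPoint

/-! ### Trivializations near a generic point -/

section GenericTrivialization

theorem IsGenericInclusion.iso_comp {N N' V : Scheme.{u}} {e : N ⟶ V} (he : IsGenericInclusion e)
    (φ : N' ⟶ N) [IsIso φ] : IsGenericInclusion (φ ≫ e) := by
  have := he.flat
  have := he.mono
  have := he.quasiCompact
  refine ⟨he.isAffine, he.isIntegral, inferInstance, inferInstance, inferInstance, ?_⟩
  rw [← he.range_eq, Scheme.Hom.comp_base, TopCat.coe_comp, Set.range_comp,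
    φ.surjective.range_eq, Set.image_univ]

variable {G : Sch k} [GrpObj G] {X Y F : Sch k} [ModObj G X] [ModObj G Y] [ModObj G F]
  {f : X ⟶ Y} [IsModHom G f]

/-- If g x = x' with both points in the fibre, then g together with the base point of x is a point
of the stabilizer whose target is the base point of x'. This removes the stabilizer from later
arguments. -/
theorem smul_eq_of_isEquivariant {y : Y.left} (Φ : fibre f y ≅ pt y ⊗ F)
    (hΦ : ∀ (T : Sch k) (h : T ⟶ stabilizer G y) (x : T ⟶ fibre f y)
      (hx : x ≫ pullback.snd f (ptι y) = h ≫ stabilizerSrc G y),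
      smulFibre f h x hx ≫ Φ.hom = smulPtProd h (x ≫ Φ.hom))
    (T : Sch k) (g : T ⟶ G) (x x' : T ⟶ fibre f y)
    (hx : g • (x ≫ pullback.fst f (ptι y)) = x' ≫ pullback.fst f (ptι y)) :
    g • (x ≫ Φ.hom ≫ snd (pt y) F) = x' ≫ Φ.hom ≫ snd (pt y) F := by
  let h : T ⟶ stabilizer G y :=
    pullback.lift (lift g (x ≫ pullback.snd f (ptι y))) (x' ≫ pullback.snd f (ptι y)) (by
      have h1 : lift g (x ≫ pullback.snd f (ptι y)) ≫ G ◁ ptι y =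
          lift g (x ≫ pullback.snd f (ptι y) ≫ ptι y) := by ext1 <;> simp
      rw [← Category.assoc, h1, comp_act, ← pullback.condition, Category.assoc,
        ← pullback.condition, ← Category.assoc x', ← hx, IsModHom.map_smul, Category.assoc])
  have h_fst : h ≫ pullback.fst _ _ = lift g (x ≫ pullback.snd f (ptι y)) :=
    pullback.lift_fst _ _ _
  have h_snd : h ≫ stabilizerTgt G y = x' ≫ pullback.snd f (ptι y) := pullback.lift_snd _ _ _
  have h_elt : h ≫ stabilizerElt G y = g := by
    rw [stabilizerElt, ← Category.assoc, h_fst, lift_fst]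
  have h_src : h ≫ stabilizerSrc G y = x ≫ pullback.snd f (ptι y) := by
    rw [stabilizerSrc, ← Category.assoc, h_fst, lift_snd]
  have hs : smulFibre f h x h_src.symm = x' := by
    apply pullback.hom_ext
    · rw [smulFibre, pullback.lift_fst, h_elt, hx]
    · rw [smulFibre, pullback.lift_snd, h_snd]
  have := congrArg (· ≫ snd (pt y) F) (hΦ T h x h_src.symm)
  simp only [hs, smulPtProd, lift_snd, h_elt, Category.assoc] at this
  exact this.symm

theorem exists_partialTrivialization (hG : IsVariety G) (hX : IsVariety X) (hY : IsVariety Y)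
    (hF : IsVariety F) (hfib : ∀ y : Y.left, IsTrivialFibre G f F y)
    {Z : Sch k} [ModObj G Z] (j : Z ⟶ Y) [IsModHom G j] [IsClosedImmersion j.left]
    [AlgebraicGeometry.IsReduced Z.left] [TopologicalSpace.NoetherianSpace Z.left]
    [Nonempty Z.left] (hZ : HasDiscreteOrbits G Z) :
    ∃ (V : Sch k) (i : V ⟶ Z), IsOpenImmersion i.left ∧ Nonempty V.left ∧
      Nonempty (PartialTrivialization G f F (i ≫ j)) := by
  have : Mono j := Over.mono_of_mono_left j
  obtain ⟨V, hV, _⟩ := exists_integral_affine_open Z.left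
  let V₀ : Sch k := Over.mk (V.ι ≫ Z.hom)
  let i₀ : V₀ ⟶ Z := Over.homMk V.ι rfl
  have : IsOpenImmersion i₀.left := inferInstanceAs (IsOpenImmersion V.ι)
  have : IsAffine V₀.left := hV
  have : AlgebraicGeometry.IsIntegral V₀.left := ‹_›
  have : SurjectiveOnStalks (i₀ ≫ j).left := by
    rw [Over.comp_left]
    infer_instance
  -- The fibre hypothesis concerns the residue field of the image point in `Y`; `φ` identifies its
  -- spectrum with the generic point of `V₀`.
  obtain ⟨φ, hφ⟩ := exists_ptIso (i₀ ≫ j) (genericPoint V₀.left)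
  have he₀ : IsGenericInclusion (φ.hom ≫ ptι (genericPoint V₀.left)).left := by
    have : IsIso φ.hom.left := inferInstanceAs (IsIso ((Over.forget _).map φ.hom))
    exact @IsGenericInclusion.iso_comp _ _ _ _ (isGenericInclusion_fromSpecResidueField V₀.left)
      φ.hom.left this
  obtain ⟨Φ, hΦ, hΦ'⟩ := hfib ((i₀ ≫ j).left (genericPoint V₀.left))
  generalize (i₀ ≫ j).left (genericPoint V₀.left) = y at φ hφ he₀ Φ hΦ hΦ'
  rw [← Category.assoc] at hφ
  obtain ⟨V₁, i₁, e₁, h₁, ⟨t⟩⟩ := exists_approxTrivialization hφ he₀ hX hY hF Φ hΦ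
  have := h₁.isOpenImmersion
  have : IsOpenImmersion (i₁ ≫ i₀).left := by
    rw [Over.comp_left]
    infer_instance
  have hy : e₁ ≫ i₁ ≫ i₀ ≫ j = ptι y := by rw [← Category.assoc, h₁.fac, hφ]
  obtain ⟨V₂, i₂, e₂, h₂, ⟨t'⟩⟩ := t.exists_partialTrivialization hy h₁.isGenericInclusion
    hG hX hY hF hΦ (smul_eq_of_isEquivariant Φ hΦ') (fun T g n v h => by
      refine hZ.exists_lift h₁.isGenericInclusion (i₁ ≫ i₀) g n v ?_
      rw [← cancel_mono j, IsModHom.map_smul]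
      simpa only [Category.assoc, hy] using h)
  have := h₂.isOpenImmersion
  have := h₂.isGenericInclusion.isIntegral
  refine ⟨V₂, i₂ ≫ i₁ ≫ i₀, ?_, inferInstance, ⟨?_⟩⟩
  · rw [Over.comp_left]
    infer_instance
  · simpa only [Category.assoc] using t'

end GenericTrivialization

/-! ### Saturation of an open subscheme -/

section Saturation

variable {G : Sch k} [GrpObj G]

/-- The union of the translates of an open subscheme is an open `G`-subscheme, of which the open
subscheme is a part meeting all orbits. -/
theorem exists_saturation (hG : LocallyOfFiniteType G.hom) {V Z : Sch k} [ModObj G Z] (i : V ⟶ Z)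
    [IsOpenImmersion i.left] :
    ∃ (U : Sch k) (_ : ModObj G U) (u : U ⟶ Z) (_ : IsModHom G u) (i' : V ⟶ U),
      IsOpenImmersion u.left ∧ i' ≫ u = i ∧ IsFlatCover (sweep G i') := by
  have hflat : Flat (sweep G i).left := by
    have := flat_act (G := G) (Z := Z)
    have := isOpenImmersion_whiskerLeft G i
    rw [sweep_eq, Over.comp_left]
    infer_instance
  have hfp : LocallyOfFinitePresentation (sweep G i).left := by
    have := locallyOfFinitePresentation_act (Z := Z) hG
    have := isOpenImmersion_whiskerLeft G i
    rw [sweep_eq, Over.comp_left]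
    infer_instance
  let R : Z.left.Opens := ⟨Set.range (sweep G i).left, (sweep G i).left.isOpenMap.isOpen_range⟩
  let U : Sch k := Over.mk (R.ι ≫ Z.hom)
  let u : U ⟶ Z := Over.homMk R.ι rfl
  have hu : IsOpenImmersion u.left := inferInstanceAs (IsOpenImmersion R.ι)
  have hr : Set.range u.left = Set.range (sweep G i).left := R.range_ι
  have : Mono u := Over.mono_of_mono_left u
  have lift_u {T : Sch k} (t : T ⟶ Z) (ht : Set.range t.left ⊆ Set.range (sweep G i).left) :
      ∃ t' : T ⟶ U, t' ≫ u = t := by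
    have hl := IsOpenImmersion.lift_fac u.left t.left (ht.trans hr.ge)
    exact ⟨Over.homMk (IsOpenImmersion.lift u.left t.left (ht.trans hr.ge))
      (by rw [← Over.w u, ← Category.assoc, hl, Over.w]), Over.OverMorphism.ext hl⟩
  obtain ⟨s, hs⟩ := lift_u (sweep G i) subset_rfl
  have hs' : s.left ≫ u.left = (sweep G i).left := by rw [← Over.comp_left, hs]
  have hsc : IsFlatCover s := by
    refine ⟨?_, ⟨fun x => ?_⟩, ?_⟩
    · exact MorphismProperty.of_isPullback (P := @Flat) (isPullback_of_mono s.left u.left)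
        (by rwa [hs'])
    · obtain ⟨w, hw⟩ : u.left x ∈ Set.range (sweep G i).left := hr ▸ ⟨x, rfl⟩
      refine ⟨w, u.left.isOpenEmbedding.injective ?_⟩
      rw [← Scheme.Hom.comp_apply, hs', hw]
    · exact MorphismProperty.of_isPullback (P := @LocallyOfFinitePresentation)
        (isPullback_of_mono s.left u.left) (by rwa [hs'])
  -- The image is invariant because g (h v) = (g h) v, checked after the surjection `G × (G × V) → G
  -- × U`.
  obtain ⟨a, ha⟩ := lift_u (fst G U • (snd G U ≫ u)) (by
    rintro _ ⟨x, rfl⟩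
    have := (hsc.whiskerLeft G).surjective
    obtain ⟨w, rfl⟩ := (G ◁ s).left.surjective x
    have e1 : G ◁ s ≫ (fst G U • (snd G U ≫ u)) =
        lift (fst G _ * (snd G (G ⊗ V) ≫ fst G V)) (snd G _ ≫ snd G V) ≫ sweep G i := by
      rw [lift_sweep, ModObj.comp_smul, mul_smul]
      simp [hs, comp_sweep]
    rw [← Scheme.Hom.comp_apply, ← Over.comp_left, e1, Over.comp_left, Scheme.Hom.comp_apply]
    exact ⟨_, rfl⟩)
  let : ModObj G U := modObjOfMono u a ha
  have : IsModHom G u := isModHom_of_mono u a ha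
  have hi' : (lift 1 (𝟙 V) ≫ s) ≫ u = i := by
    rw [Category.assoc, hs, lift_sweep, one_smul, Category.id_comp]
  refine ⟨U, inferInstance, u, this, lift 1 (𝟙 V) ≫ s, hu, hi', ?_⟩
  suffices sweep G (lift 1 (𝟙 V) ≫ s) = s by rwa [this]
  rw [← cancel_mono u, sweep, IsModHom.map_smul, Category.assoc, hi', hs, sweep]

theorem exists_trivial_open {X Y F : Sch k} [ModObj G X] [ModObj G Y] [ModObj G F]
    {f : X ⟶ Y} [IsModHom G f] (hG : IsVariety G) (hX : IsVariety X) (hY : IsVariety Y)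
    (hF : IsVariety F) (hfib : ∀ y : Y.left, IsTrivialFibre G f F y)
    {Z : Sch k} [ModObj G Z] (j : Z ⟶ Y) [IsModHom G j] [IsClosedImmersion j.left]
    [AlgebraicGeometry.IsReduced Z.left] [TopologicalSpace.NoetherianSpace Z.left]
    [Nonempty Z.left] (hZ : HasDiscreteOrbits G Z) :
    ∃ (U : Sch k) (_ : ModObj G U) (u : U ⟶ Z) (_ : IsModHom G u) (_ : IsModHom G (u ≫ j)),
      IsOpenImmersion u.left ∧ Nonempty U.left ∧ IsTrivialOverStratum G f (u ≫ j) F := by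
  obtain ⟨V, i, _, ⟨x⟩, ⟨t⟩⟩ := exists_partialTrivialization hG hX hY hF hfib j hZ
  obtain ⟨U, _, u, _, i', hu, rfl, hi'⟩ := exists_saturation hG.locallyOfFiniteType i
  have : Mono (i' ≫ u) := Over.mono_of_mono_left (i' ≫ u)
  have : Mono i' := mono_of_mono i' u
  have h : IsModHom G (u ≫ j) := inferInstance
  rw [Category.assoc] at t
  exact ⟨U, inferInstance, u, inferInstance, h, hu, ⟨i'.left x⟩,
    t.isTrivialOverStratum (u ≫ j) i' hi'⟩

end Saturation

/-! ### Reduced closed subschemes -/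

section ReducedStructure

open Scheme.IdealSheafData

theorem isReduced_subscheme_vanishingIdeal {X : Scheme.{u}} (C : TopologicalSpace.Closeds X) :
    AlgebraicGeometry.IsReduced (vanishingIdeal C).subscheme := by
  have h (U : X.affineOpens) : _root_.IsReduced (Γ(X, U.1) ⧸ (vanishingIdeal C).ideal U) := by
    rw [← Ideal.isRadical_iff_quotient_reduced, vanishingIdeal_ideal]
    exact PrimeSpectrum.isRadical_vanishingIdeal _
  refine @IsReduced.of_openCover _ (vanishingIdeal C).subschemeCover.openCover fun U => ?_
  have := h U
  exact inferInstanceAs (AlgebraicGeometry.IsReduced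
    (Spec (.of (Γ(X, (show X.affineOpens from U).1) ⧸ (vanishingIdeal C).ideal U))))

theorem vanishingIdeal_le_ker {X T : Scheme.{u}} [AlgebraicGeometry.IsReduced T] (g : T ⟶ X)
    (C : TopologicalSpace.Closeds X) (hg : Set.range g ⊆ C) : vanishingIdeal C ≤ g.ker := by
  rw [← map_bot, ← Scheme.nilradical_eq_bot, ← vanishingIdeal_top, map_vanishingIdeal]
  refine vanishingIdeal_antimono ?_
  rw [TopologicalSpace.Closeds.closure_le]
  simpa using hg

end ReducedStructure

/-! ### Stratification -/

section Stratification

variable {G : Sch k} [GrpObj G]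

theorem exists_preimage_of_isPullback {P A B D : Scheme.{u}} {a : P ⟶ A} {b : P ⟶ B} {f : A ⟶ D}
    {g : B ⟶ D} (h : IsPullback a b f g) (x : A) (y : B) (hxy : f x = g y) :
    ∃ w : P, a w = x ∧ b w = y := by
  obtain ⟨w, rfl, rfl⟩ := Scheme.Pullback.exists_preimage_pullback x y hxy
  refine ⟨h.isoPullback.inv w, ?_, ?_⟩ <;> rw [← Scheme.Hom.comp_apply] <;> simp

theorem act_mem_range {S Y : Sch k} [ModObj G S] [ModObj G Y] (j : S ⟶ Y) [IsModHom G j]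
    (z : (G ⊗ Y : Sch k).left) (hz : (snd G Y).left z ∈ Set.range j.left) :
    (act G Y).left z ∈ Set.range j.left := by
  obtain ⟨s, hs⟩ := hz
  have h := (isPullback_whiskerLeft_snd G j).map (Over.forget _)
  obtain ⟨w, -, rfl⟩ : ∃ w, (snd G S).left w = s ∧ (G ◁ j).left w = z :=
    exists_preimage_of_isPullback h s z hs
  have hj : G ◁ j ≫ act G Y = act G S ≫ j := (IsModHom.smul_hom (f := j)).symm
  rw [← Scheme.Hom.comp_apply, ← Over.comp_left, hj, Over.comp_left, Scheme.Hom.comp_apply]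
  exact ⟨_, rfl⟩

/-- Apply `act_mem_range` to the inverse group element, by means of `shear`. This makes the
complement of an invariant subset invariant. -/
theorem snd_mem_range {S Y : Sch k} [ModObj G S] [ModObj G Y] (j : S ⟶ Y) [IsModHom G j]
    (z : (G ⊗ Y : Sch k).left) (hz : (act G Y).left z ∈ Set.range j.left) :
    (snd G Y).left z ∈ Set.range j.left := by
  have := act_mem_range j ((shear G Y).left z) (by
    rwa [← Scheme.Hom.comp_apply, ← Over.comp_left, shear_snd])
  rwa [← Scheme.Hom.comp_apply, ← Over.comp_left, shear_act] at this

theorem HasDiscreteOrbits.of_immersion {Z Y : Sch k} [ModObj G Z] [ModObj G Y]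
    (hY : HasDiscreteOrbits G Y) (j : Z ⟶ Y) [IsModHom G j] [IsImmersion j.left] :
    HasDiscreteOrbits G Z := by
  refine hY.imp_left fun ⟨Q, q, hq, _⟩ => ⟨Q, j ≫ q, ?_, ?_⟩
  · have hj : act G Z ≫ j = G ◁ j ≫ act G Y := IsModHom.smul_hom
    rw [reassoc_of% hj, hq, whiskerLeft_snd_assoc]
  · rw [Over.comp_left]
    infer_instance

/-- An invariant closed subset, with its reduced structure and the induced action. -/
theorem exists_reduced_closed_subscheme [CharZero k] {Y : Sch k} [ModObj G Y] (hG : IsVariety G)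
    (hY : IsVariety Y) (C : TopologicalSpace.Closeds Y.left)
    (hC : ∀ z : (G ⊗ Y : Sch k).left, (snd G Y).left z ∈ C → (act G Y).left z ∈ C) :
    ∃ (Z : Sch k) (_ : ModObj G Z) (j : Z ⟶ Y) (_ : IsModHom G j),
      IsClosedImmersion j.left ∧ AlgebraicGeometry.IsReduced Z.left ∧ Set.range j.left = C := by
  let I := Scheme.IdealSheafData.vanishingIdeal C
  let Z : Sch k := Over.mk (I.subschemeι ≫ Y.hom)
  let j : Z ⟶ Y := Over.homMk I.subschemeι rfl
  have hj : IsClosedImmersion j.left := inferInstanceAs (IsClosedImmersion I.subschemeι)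
  have : Mono j := Over.mono_of_mono_left j
  have hr : Set.range j.left = C := I.range_subschemeι
  have : AlgebraicGeometry.IsReduced Z.left := isReduced_subscheme_vanishingIdeal C
  have := hG.isReduced
  have := hY.locallyOfFiniteType
  have : LocallyOfFiniteType Z.hom := by
    rw [← Over.w j]
    infer_instance
  have hred : AlgebraicGeometry.IsReduced (G ⊗ Z).left := isReduced_tensorObj G Z
  -- Reducedness of `G ⊗ Z` turns the set-theoretic inclusion of the image in `C` into a
  -- factorization through `Z`.
  have hle : j.left.ker ≤ (sweep G j).left.ker := by
    refine I.ker_subschemeι.le.trans (vanishingIdeal_le_ker _ C ?_)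
    rintro _ ⟨x, rfl⟩
    rw [sweep_eq, Over.comp_left, Scheme.Hom.comp_apply]
    refine hC _ ?_
    rw [← Scheme.Hom.comp_apply, ← Over.comp_left, whiskerLeft_snd, Over.comp_left,
      Scheme.Hom.comp_apply]
    exact hr.le ⟨_, rfl⟩
  have hl := IsClosedImmersion.lift_fac j.left (sweep G j).left hle
  let a : G ⊗ Z ⟶ Z := Over.homMk (IsClosedImmersion.lift j.left (sweep G j).left hle)
    (by rw [← Over.w j, ← Category.assoc, hl, Over.w])
  have ha : a ≫ j = sweep G j := Over.OverMorphism.ext hl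
  exact ⟨Z, modObjOfMono j a ha, j, isModHom_of_mono j a ha, hj, ‹_›, hr⟩

variable {X Y : Sch k} [ModObj G X] [ModObj G Y]

/-- A reduced locally closed `G`-subscheme over which `f` is trivial. -/
structure Stratum (G : Sch k) [GrpObj G] {X Y : Sch k} [ModObj G X] [ModObj G Y]
    (f : X ⟶ Y) [IsModHom G f] (F : Sch k) [ModObj G F] where
  carrier : Sch k
  modObj : ModObj G carrier
  incl : carrier ⟶ Y
  isModHom : IsModHom G incl
  isReduced : AlgebraicGeometry.IsReduced carrier.left
  isImmersion : IsImmersion incl.left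
  isTrivial : IsTrivialOverStratum G f incl F

/-- Noetherian induction: `exists_trivial_open` gives one stratum, open in `C`; what remains is a
strictly smaller invariant closed subset. -/
theorem exists_strata [CharZero k] {F : Sch k} [ModObj G F] {f : X ⟶ Y} [IsModHom G f]
    (hG : IsVariety G) (hX : IsVariety X) (hY : IsVariety Y) (hF : IsVariety F)
    (hfib : ∀ y : Y.left, IsTrivialFibre G f F y) (hYG : HasDiscreteOrbits G Y)
    [TopologicalSpace.NoetherianSpace Y.left] (C : TopologicalSpace.Closeds Y.left)
    (hC : ∀ z : (G ⊗ Y : Sch k).left, (snd G Y).left z ∈ C → (act G Y).left z ∈ C) :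
    ∃ (n : ℕ) (s : Fin n → Stratum G f F),
      (Pairwise fun a b => Disjoint (Set.range (s a).incl.left) (Set.range (s b).incl.left)) ∧
      (⋃ a, Set.range (s a).incl.left) = C := by
  induction C using WellFoundedLT.induction with
  | ind C ih =>
  obtain ⟨Z, _, j, _, _, _, hr⟩ := exists_reduced_closed_subscheme hG hY C hC
  rcases isEmpty_or_nonempty Z.left with hZ | hZ
  · refine ⟨0, Fin.elim0, fun a => a.elim0, ?_⟩
    rw [← hr, Set.range_eq_empty, Set.iUnion_of_empty]
  have : TopologicalSpace.NoetherianSpace Z.left :=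
    j.left.isClosedEmbedding.isInducing.noetherianSpace
  obtain ⟨U, _, u, _, _, hu, ⟨x⟩, hU⟩ :=
    exists_trivial_open hG hX hY hF hfib j (hYG.of_immersion j)
  let s₀ : Stratum G f F := ⟨U, inferInstance, u ≫ j, inferInstance,
    isReduced_of_isOpenImmersion u.left, by rw [Over.comp_left]; infer_instance, hU⟩
  have hs₀ : Set.range s₀.incl.left ⊆ C := by
    rintro _ ⟨x, rfl⟩
    rw [← hr]
    exact ⟨u.left x, by rw [← Scheme.Hom.comp_apply, ← Over.comp_left]⟩
  let C' : TopologicalSpace.Closeds Y.left := ⟨C \ Set.range s₀.incl.left, by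
    have h : (C : Set Y.left) \ Set.range s₀.incl.left = j.left '' (Set.range u.left)ᶜ := by
      rw [Set.image_compl_eq_range_sdiff_image j.left.isClosedEmbedding.injective, hr,
        ← Set.range_comp]
      rfl
    rw [h]
    exact j.left.isClosedEmbedding.isClosedMap _ u.left.isOpenEmbedding.isOpen_range.isClosed_compl⟩
  have hlt : C' < C := by
    refine lt_of_le_of_ne (fun y hy => hy.1) fun h => ?_
    have hx : s₀.incl.left x ∈ C := hs₀ ⟨x, rfl⟩
    rw [← h] at hx
    exact hx.2 ⟨x, rfl⟩
  obtain ⟨n, s, hs, hsC⟩ := ih C' hlt (fun z hz => ⟨hC z hz.1, fun h =>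
    hz.2 (snd_mem_range (u ≫ j) z h)⟩)
  have hdisj (a : Fin n) : Disjoint (Set.range s₀.incl.left) (Set.range (s a).incl.left) := by
    refine Set.disjoint_left.mpr fun y hy hy' => ?_
    have : y ∈ (C' : Set Y.left) := hsC ▸ Set.mem_iUnion.mpr ⟨a, hy'⟩
    exact this.2 hy
  refine ⟨n + 1, Fin.cons s₀ s, ?_, ?_⟩
  · intro a b
    refine Fin.cases ?_ (fun a => ?_) a <;> refine Fin.cases ?_ (fun b => ?_) b
    · exact fun h => absurd rfl h
    · exact fun _ => hdisj b
    · exact fun _ => (hdisj a).symm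
    · exact fun h => hs (fun hab => h (congrArg Fin.succ hab))
  · refine Eq.trans ?_ ((congrArg (Set.range s₀.incl.left ∪ ·) hsC).trans
      (Set.union_sdiff_cancel hs₀))
    ext y
    simp only [Set.mem_iUnion, Fin.exists_fin_succ, Set.mem_union]
    rfl

end Stratification

/-! ### From strata to fibres -/

section Fibres

variable {G : Sch k} [GrpObj G] {X Y F S : Sch k} [ModObj G X] [ModObj G Y] [ModObj G F]
  [ModObj G S] {f : X ⟶ Y} [IsModHom G f] {j : S ⟶ Y} [IsModHom G j]

theorem IsTrivialOverStratum.isTrivialFibre (h : IsTrivialOverStratum G f j F) [Mono j]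
    {y : Y.left} (e : pt y ⟶ S) (he : e ≫ j = ptι y) : IsTrivialFibre G f F y := by
  obtain ⟨Φ, hΦ, hΦ'⟩ := h
  have hΦi : Φ.inv ≫ pullback.snd f j = fst S F := by rw [Iso.inv_comp_eq, hΦ]
  let c : fibre f y ⟶ pullback f j :=
    pullback.lift (pullback.fst f (ptι y)) (pullback.snd f (ptι y) ≫ e) (by
      rw [Category.assoc, he, pullback.condition])
  have c_fst : c ≫ pullback.fst f j = pullback.fst f (ptι y) := pullback.lift_fst _ _ _
  have c_snd : c ≫ pullback.snd f j = pullback.snd f (ptι y) ≫ e := pullback.lift_snd _ _ _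
  let ψ : fibre f y ⟶ pt y ⊗ F := lift (pullback.snd f (ptι y)) (c ≫ Φ.hom ≫ snd S F)
  let ω : pt y ⊗ F ⟶ fibre f y := pullback.lift (e ▷ F ≫ Φ.inv ≫ pullback.fst f j) (fst _ _) (by
    rw [Category.assoc, Category.assoc, pullback.condition, reassoc_of% hΦi,
      whiskerRight_fst_assoc, he])
  have ω_fst : ω ≫ pullback.fst f (ptι y) = e ▷ F ≫ Φ.inv ≫ pullback.fst f j :=
    pullback.lift_fst _ _ _
  have ω_snd : ω ≫ pullback.snd f (ptι y) = fst _ _ := pullback.lift_snd _ _ _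
  have hψ : ψ ≫ e ▷ F = c ≫ Φ.hom := by
    ext1
    · rw [Category.assoc, whiskerRight_fst, lift_fst_assoc, Category.assoc, hΦ, c_snd]
    · rw [Category.assoc, whiskerRight_snd, lift_snd, Category.assoc]
  have hω : ω ≫ c = e ▷ F ≫ Φ.inv := by
    apply pullback.hom_ext
    · rw [Category.assoc, c_fst, ω_fst, Category.assoc]
    · rw [Category.assoc, c_snd, reassoc_of% ω_snd, Category.assoc, hΦi, whiskerRight_fst]
  have hψω : ψ ≫ ω = 𝟙 _ := by
    apply pullback.hom_ext
    · rw [Category.assoc, ω_fst, reassoc_of% hψ, Iso.hom_inv_id_assoc, c_fst, Category.id_comp]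
    · rw [Category.assoc, ω_snd, lift_fst, Category.id_comp]
  have hωψ : ω ≫ ψ = 𝟙 _ := by
    ext1
    · rw [Category.assoc, lift_fst, ω_snd, Category.id_comp]
    · rw [Category.assoc, lift_snd, reassoc_of% hω, Iso.inv_hom_id_assoc, whiskerRight_snd,
        Category.id_comp]
  refine ⟨⟨ψ, ω, hψω, hωψ⟩, lift_fst _ _, fun T h x hx => ?_⟩
  -- The stabilizer action on the fibre is induced from the action over the stratum; the base
  -- coordinates are compared in `Y`, as `j` is a monomorphism.
  have hs : smulFibre f h x hx ≫ c = smulPullback f j (h ≫ stabilizerElt G y) (x ≫ c) := by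
    apply pullback.hom_ext
    · rw [Category.assoc, c_fst, smulFibre, pullback.lift_fst, smulPullback, pullback.lift_fst,
        Category.assoc, c_fst]
    · rw [Category.assoc, c_snd, smulFibre, pullback.lift_snd_assoc, smulPullback,
        pullback.lift_snd, Category.assoc x, c_snd, ← cancel_mono j, IsModHom.map_smul,
        ← Category.assoc x, hx, Category.assoc _ e, he,
        Category.assoc _ e, he, stabilizer_smul]
  ext1
  · rw [Category.assoc, smulPtProd, lift_fst, lift_fst, smulFibre, pullback.lift_snd]
  · have := congrArg (· ≫ snd S F) (hΦ' T (h ≫ stabilizerElt G y) (x ≫ c))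
    rw [← hs] at this
    simp only [smulProd, lift_snd, Category.assoc] at this
    rw [Category.assoc, lift_snd, this, smulPtProd, lift_snd, Category.assoc, lift_snd]

theorem IsPiecewiseTrivialFibration.isTrivialFibre (h : IsPiecewiseTrivialFibration G f F)
    (y : Y.left) : IsTrivialFibre G f F y := by
  obtain ⟨n, S, _, j, _, hj, -, hU, htriv⟩ := h
  obtain ⟨i, s, rfl⟩ := Set.mem_iUnion.mp (hU.ge (Set.mem_univ y))
  have := (hj i).2
  have : Mono (j i) := Over.mono_of_mono_left (j i)
  obtain ⟨φ, hφ⟩ := exists_ptIso (j i) s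
  exact (htriv i).isTrivialFibre (φ.hom ≫ ptι s) (by rw [Category.assoc, hφ])

end Fibres

theorem IsVariety.noetherianSpace {Y : Sch k} (hY : IsVariety Y) :
    TopologicalSpace.NoetherianSpace Y.left := by
  have := hY.locallyOfFiniteType
  have := hY.quasiCompact
  have : IsLocallyNoetherian Y.left := LocallyOfFiniteType.isLocallyNoetherian Y.hom
  have : CompactSpace Y.left := QuasiCompact.compactSpace_of_compactSpace Y.hom
  have : IsNoetherian Y.left := {}
  infer_instance

end EquivariantFibration
end

open EquivariantFibration in
theorem theorem2p2 {k : Type u} [Field k] [CharZero k]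
    (G : Sch k) [GrpObj G] (hG : IsVariety G)
    (X Y F : Sch k) [ModObj G X] [ModObj G Y] [ModObj G F]
    (hX : IsVariety X) (hY : IsVariety Y) (hF : IsVariety F)
    (hXgood : IsGoodAction G X) (hYgood : IsGoodAction G Y) (hFgood : IsGoodAction G F)
    (f : X ⟶ Y) [IsModHom G f]
    (hquot : (∃ (Q : Sch k) (q : Y ⟶ Q), IsCategoricalQuotient G q ∧ IsQuasiFinite q.left) ∨
      IsFinite G.hom) :
    IsPiecewiseTrivialFibration G f F ↔ ∀ y : Y.left, IsTrivialFibre G f F y := by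
  refine ⟨fun h y => h.isTrivialFibre y, fun hfib => ?_⟩
  have := hY.noetherianSpace
  have hYG : HasDiscreteOrbits G Y := hquot.imp_left fun ⟨Q, q, hq, hq'⟩ =>
    ⟨Q, q, hq.invariant, hq'.locallyQuasiFinite⟩
  obtain ⟨n, s, hs, hsU⟩ := exists_strata hG hX hY hF hfib hYG ⊤ (fun _ _ => trivial)
  exact ⟨n, fun i => (s i).carrier, fun i => (s i).modObj, fun i => (s i).incl,
    fun i => (s i).isModHom, fun i => ⟨(s i).isReduced, (s i).isImmersion⟩, hs, hsU,
    fun i => (s i).isTrivial⟩
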